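/- Let $\mathbb{D}$ be the open unit disk and $dA$ the normalized area measure on it. For real $\gamma$ let $dA_\gamma(z)=(1-|z|^2)^\gamma\,dA(z)$, multiplied by $\gamma+1$ when $\gamma>-1$ so that $A_\gamma(\mathbb{D})=1$, and let $A^2_\gamma$ be the space of analytic functions $f$ on $\mathbb{D}$ with $$\int_{\mathbb{D}}(1-|z|^2)^{2k}\,|f^{(k)}(z)|^2\,dA_\gamma(z)<\infty,$$ where $k$ is the smallest non-negative integer with $2k+\gamma>-1$. (It is well known that any other non-negative integer $k$ with $2k+\gamma>-1$ gives the same space.) Let $\alpha>-1$, so that $A^2_\alpha$ is a Hilbert space with the inner product $\langle f,g\rangle=\int_{\mathbb{D}}f\overline g\,dA_\alpha$. Let $\varphi$ be an analytic function on $\mathbb{D}$ with $\sup_{\mathbb{D}}|\varphi|\le1$ which is not a constant of modulus $1$. Let $T_\varphi f=\varphi f$ be the multiplication operator on $A^2_\alpha$, and let $E^\alpha_\varphi=I-T_\varphi T_\varphi^*$, where $T_\varphi^*$ is the Hilbert space adjoint of $T_\varphi$. Then the following conditions are equivalent: (a) $E^\alpha_\varphi$ is a compact operator on $A^2_\alpha$;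 (b) $\varphi$ is a finite Blaschke product, that is, $\varphi(z)=\zeta\prod_{i=1}^n\frac{z-a_i}{1-\overline{a_i}z}$ for some $n\ge0$, $|\zeta|=1$ and $a_1,\dots,a_n\in\mathbb{D}$; (c) the range $E^\alpha_\varphi(A^2_\alpha)$ equals $A^2_{\alpha-2}$; (d) the range $E^\alpha_\varphi(A^2_\alpha)$ is contained in $A^2_{\alpha-2}$. -/

import Mathlib

open MeasureTheory Metric Set Filter Topology
open scoped ENNReal NNReal ComplexConjugate

noncomputable section

/-- The open unit disk of the complex plane. -/
def unitDisk : Set ℂ := ball (0 : ℂ) 1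

/-- The constant in front of `(1 - |z|²)^γ`: it makes the total mass `1` when the weighted measure
is finite (that is, when `γ > -1`), and is `1` otherwise. -/
def weightConst (γ : ℝ) : ℝ := if -1 < γ then γ + 1 else 1

/-- The weighted area measure `dA_γ(z) = c_γ (1 - |z|²)^γ dA(z)` on the unit disk, where
`dA = π⁻¹ dx dy` is the normalized area measure. -/
def weightedArea (γ : ℝ) : Measure ℂ :=
  (volume.restrict unitDisk).withDensity
    (fun z => ENNReal.ofReal (weightConst γ * Real.pi⁻¹ * (1 - ‖z‖ ^ 2) ^ γ))

/-- The order of the derivative used to define `A²_γ`: the smallest natural number `k` with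
`2 * k + γ > -1`. -/
def bergmanOrder (γ : ℝ) : ℕ := ⌊(1 - γ) / 2⌋₊

theorem bergmanOrder_spec (γ : ℝ) : -1 < 2 * (bergmanOrder γ : ℝ) + γ := by
  have := Nat.lt_floor_add_one ((1 - γ) / 2)
  unfold bergmanOrder
  linarith

theorem bergmanOrder_le (γ : ℝ) (k : ℕ) (hk : -1 < 2 * (k : ℝ) + γ) : bergmanOrder γ ≤ k := by
  refine Nat.lt_succ_iff.1 ((Nat.floor_lt' k.succ_ne_zero).2 ?_)
  push_cast
  linarith

theorem bergmanOrder_eq_zero {γ : ℝ} (h : -1 < γ) : bergmanOrder γ = 0 :=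
  Nat.le_zero.1 (bergmanOrder_le γ 0 (by simpa using h))

/-- Membership in `A²_γ`. A function on the unit disk is represented by its extension by zero to
the complex plane, so that two elements are equal exactly when they agree on the disk. The last
condition says `∫ (1 - |z|²)^(2k) |f^(k)(z)|² dA_γ(z) < ∞`. -/
structure MemBergman (γ : ℝ) (f : ℂ → ℂ) : Prop where
  differentiableOn : DifferentiableOn ℂ f unitDisk
  eq_zero : ∀ z, z ∉ unitDisk → f z = 0
  memLp : MemLp (fun z => ((1 - ‖z‖ ^ 2 : ℝ) : ℂ) ^ bergmanOrder γ *
    iteratedDeriv (bergmanOrder γ) f z) 2 (weightedArea γ)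

theorem isOpen_unitDisk : IsOpen unitDisk := isOpen_ball

theorem contDiffAt_of_differentiableOn_unitDisk {f : ℂ → ℂ} (hf : DifferentiableOn ℂ f unitDisk)
    {z : ℂ} (hz : z ∈ unitDisk) (n : ℕ) : ContDiffAt ℂ n f z :=
  (hf.contDiffOn isOpen_unitDisk).contDiffAt (isOpen_unitDisk.mem_nhds hz)

theorem ae_mem_unitDisk (γ : ℝ) : ∀ᵐ z ∂weightedArea γ, z ∈ unitDisk :=
  (withDensity_absolutelyContinuous _ _).ae_le
    (ae_restrict_mem isOpen_unitDisk.measurableSet)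

/-- The generalized Bergman space `A²_γ`, for an arbitrary real `γ`, as a space of functions. -/
def bergman (γ : ℝ) : Submodule ℂ (ℂ → ℂ) where
  carrier := {f | MemBergman γ f}
  zero_mem' := ⟨differentiableOn_const 0, fun _ _ => rfl, by simp⟩
  add_mem' := by
    intro f g hf hg
    refine ⟨hf.1.add hg.1, fun z hz => by simp [hf.2 z hz, hg.2 z hz], ?_⟩
    refine (hf.3.add hg.3).ae_eq ?_
    filter_upwards [ae_mem_unitDisk γ] with z hz
    rw [iteratedDeriv_add (contDiffAt_of_differentiableOn_unitDisk hf.1 hz _)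
      (contDiffAt_of_differentiableOn_unitDisk hg.1 hz _)]
    simp [mul_add]
  smul_mem' := by
    intro c f hf
    refine ⟨hf.1.const_smul c, fun z hz => by simp [hf.2 z hz], ?_⟩
    refine (hf.3.const_smul c).ae_eq ?_
    filter_upwards [ae_mem_unitDisk γ] with z hz
    rw [iteratedDeriv_const_smul (contDiffAt_of_differentiableOn_unitDisk hf.1 hz _) c]
    simp [mul_left_comm]

theorem mem_bergman_iff {γ : ℝ} {f : ℂ → ℂ} : f ∈ bergman γ ↔ MemBergman γ f := Iff.rfl

/-- For `γ > -1` the definition says that `f` is square integrable. -/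
theorem mem_bergman_iff_of_neg_one_lt {α : ℝ} (h : -1 < α) {f : ℂ → ℂ} :
    f ∈ bergman α ↔ DifferentiableOn ℂ f unitDisk ∧ (∀ z, z ∉ unitDisk → f z = 0) ∧
      MemLp f 2 (weightedArea α) := by
  rw [mem_bergman_iff]
  constructor
  · rintro ⟨h1, h2, h3⟩
    exact ⟨h1, h2, by simpa [bergmanOrder_eq_zero h] using h3⟩
  · rintro ⟨h1, h2, h3⟩
    exact ⟨h1, h2, by simpa [bergmanOrder_eq_zero h] using h3⟩

/-- `A²_α` as a type, to be equipped with its Hilbert space structure when `α > -1`. -/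
def BergmanSpace (α : ℝ) : Type := ↥(bergman α)

namespace BergmanSpace

variable {α : ℝ}

instance : AddCommGroup (BergmanSpace α) := inferInstanceAs (AddCommGroup ↥(bergman α))

instance : Module ℂ (BergmanSpace α) := inferInstanceAs (Module ℂ ↥(bergman α))

/-- The function underlying an element of `A²_α`. -/
def toFun (f : BergmanSpace α) : ℂ → ℂ := Subtype.val f

instance : CoeFun (BergmanSpace α) (fun _ => ℂ → ℂ) := ⟨toFun⟩

@[ext] theorem ext {f g : BergmanSpace α} (h : ∀ z, f z = g z) : f = g :=
  Subtype.ext (funext h)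

@[simp] theorem add_apply (f g : BergmanSpace α) (z : ℂ) : (f + g) z = f z + g z := rfl

@[simp] theorem sub_apply (f g : BergmanSpace α) (z : ℂ) : (f - g) z = f z - g z := rfl

@[simp] theorem zero_apply (z : ℂ) : (0 : BergmanSpace α) z = 0 := rfl

@[simp] theorem smul_apply (c : ℂ) (f : BergmanSpace α) (z : ℂ) : (c • f) z = c * f z := rfl

theorem differentiableOn (f : BergmanSpace α) : DifferentiableOn ℂ f unitDisk := f.2.1

theorem eq_zero_of_notMem (f : BergmanSpace α) {z : ℂ} (hz : z ∉ unitDisk) : f z = 0 :=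
  f.2.2 z hz

theorem measurable (f : BergmanSpace α) : Measurable (f : ℂ → ℂ) := by
  classical
  have h : (f : ℂ → ℂ) = unitDisk.piecewise f 0 := by
    ext z
    by_cases hz : z ∈ unitDisk
    · simp [hz]
    · simp [hz, f.eq_zero_of_notMem hz]
  rw [h]
  exact f.differentiableOn.continuousOn.measurable_piecewise continuousOn_const
    isOpen_unitDisk.measurableSet

theorem memLp [hα : Fact (-1 < α)] (f : BergmanSpace α) : MemLp f 2 (weightedArea α) :=
  ((mem_bergman_iff_of_neg_one_lt hα.out).1 f.2).2.2

theorem density_pos [hα : Fact (-1 < α)] {z : ℂ} (hz : z ∈ unitDisk) :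
    0 < weightConst α * Real.pi⁻¹ * (1 - ‖z‖ ^ 2) ^ α := by
  have h1 : ‖z‖ < 1 := by simpa [unitDisk] using hz
  have h2 : 0 < 1 - ‖z‖ ^ 2 := by nlinarith [norm_nonneg z]
  have h3 : 0 < weightConst α := by
    have := hα.out
    simp only [weightConst, this, if_true]
    linarith
  have := Real.pi_pos
  positivity

theorem ae_weightedArea_iff [Fact (-1 < α)] {p : ℂ → Prop} :
    (∀ᵐ z ∂weightedArea α, p z) ↔ ∀ᵐ z ∂volume.restrict unitDisk, p z := by
  refine ⟨fun h => ?_, fun h => (withDensity_absolutelyContinuous _ _).ae_le h⟩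
  rw [weightedArea, ae_withDensity_iff (by fun_prop)] at h
  filter_upwards [h, ae_restrict_mem isOpen_unitDisk.measurableSet] with z h1 h2
  exact h1 (by simpa using density_pos h2)

theorem integrable_conj_mul [Fact (-1 < α)] (f g : BergmanSpace α) :
    Integrable (fun z => conj (f z) * g z) (weightedArea α) :=
  MemLp.integrable_mul (p := 2) (q := 2) f.memLp.star g.memLp

/-- An element of `A²_α` vanishing almost everywhere is zero. -/
theorem eq_zero_of_ae [Fact (-1 < α)] (f : BergmanSpace α)
    (h : ∀ᵐ z ∂weightedArea α, f z = 0) : f = 0 := by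
  rw [ae_weightedArea_iff] at h
  have h' : EqOn f 0 unitDisk :=
    Measure.eqOn_open_of_ae_eq h isOpen_unitDisk f.differentiableOn.continuousOn
      continuousOn_const
  ext z
  by_cases hz : z ∈ unitDisk
  · exact h' hz
  · exact f.eq_zero_of_notMem hz

/-- The inner product `∫ f \bar g dA_α` of `L²(dA_α)` (written here conjugate linear in the first
variable). -/
@[reducible] def core [Fact (-1 < α)] : InnerProductSpace.Core ℂ (BergmanSpace α) where
  inner f g := ∫ z, conj (f z) * g z ∂weightedArea α
  conj_inner_symm f g := by
    rw [← integral_conj]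
    simp [mul_comm]
  re_inner_nonneg f := by
    have : ∀ z, conj (f z) * f z = ((‖f z‖ ^ 2 : ℝ) : ℂ) := fun z => by
      simp [Complex.conj_mul']
    simp_rw [this, integral_complex_ofReal]
    exact integral_nonneg (fun z => by positivity)
  add_left f g h := by
    rw [← integral_add (integrable_conj_mul f h) (integrable_conj_mul g h)]
    simp [add_mul]
  smul_left f g c := by
    rw [← integral_const_mul]
    simp [mul_assoc]
  definite f hf := by
    apply f.eq_zero_of_ae
    have : ∀ z, conj (f z) * f z = ((‖f z‖ ^ 2 : ℝ) : ℂ) := fun z => by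
      simp [Complex.conj_mul']
    simp_rw [this, integral_complex_ofReal, Complex.ofReal_eq_zero] at hf
    have hi : Integrable (fun z => ‖f z‖ ^ 2) (weightedArea α) :=
      f.memLp.integrable_norm_pow (by simp)
    rw [integral_eq_zero_iff_of_nonneg (fun z => by positivity) hi] at hf
    filter_upwards [hf] with z hz
    simpa using hz

instance [Fact (-1 < α)] : NormedAddCommGroup (BergmanSpace α) :=
  (core (α := α)).toNormedAddCommGroup

instance [Fact (-1 < α)] : InnerProductSpace ℂ (BergmanSpace α) :=
  InnerProductSpace.ofCore (core (α := α)).toCore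

theorem inner_def [Fact (-1 < α)] (f g : BergmanSpace α) :
    inner ℂ f g = ∫ z, conj (f z) * g z ∂weightedArea α := rfl

theorem norm_sq_eq [Fact (-1 < α)] (f : BergmanSpace α) :
    ‖f‖ ^ 2 = ∫ z, ‖f z‖ ^ 2 ∂weightedArea α := by
  have h := inner_self_eq_norm_sq_to_K (𝕜 := ℂ) f
  have : ∀ z, conj (f z) * f z = ((‖f z‖ ^ 2 : ℝ) : ℂ) := fun z => by
    simp [Complex.conj_mul']
  rw [inner_def] at h
  simp_rw [this, integral_complex_ofReal] at h
  exact Complex.ofReal_injective (by simpa using h.symm)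

/-- Mean value inequality over a disk. -/
theorem enorm_mul_le_lintegral {g : ℂ → ℂ} {z : ℂ} {δ : ℝ} (hg : Measurable g)
    (hd : DifferentiableOn ℂ g (ball z δ)) :
    ‖g z‖ₑ * volume (ball z δ) ≤ ∫⁻ w in ball z δ, ‖g w‖ₑ := by
  have key : ∀ s ∈ Ioo 0 δ, ∫⁻ _ in Ioo (-Real.pi) Real.pi, ‖g z‖ₑ ≤
      ∫⁻ θ in Ioo (-Real.pi) Real.pi, ‖g (z + Complex.polarCoord.symm (s, θ))‖ₑ := by
    intro s hs
    have hsub : closedBall z |s| ⊆ ball z δ := by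
      rw [abs_of_pos hs.1]
      exact closedBall_subset_ball hs.2
    have hc : DiffContOnCl ℂ g (ball z |s|) := by
      refine DifferentiableOn.diffContOnCl ?_
      rw [closure_ball _ (by simpa using hs.1.ne')]
      exact hd.mono hsub
    have hm := hc.circleAverage
    rw [Real.circleAverage_eq_integral_add (-Real.pi),
      intervalIntegral.integral_comp_add_right (fun θ => g (circleMap z s θ)),
      zero_add, show 2 * Real.pi + -Real.pi = Real.pi by ring,
      intervalIntegral.integral_of_le (by linarith [Real.pi_pos])] at hm
    have hp : (0 : ℝ) < 2 * Real.pi := by positivity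
    have hpol : ∀ θ : ℝ, z + Complex.polarCoord.symm (s, θ) = circleMap z s θ := by
      intro θ
      simp [circleMap, Complex.exp_mul_I]
    simp_rw [hpol]
    have h2 : ((2 * Real.pi : ℝ) : ℂ) * g z = ∫ θ in Ioc (-Real.pi) Real.pi, g (circleMap z s θ) := by
      rw [← hm, Complex.real_smul, ← mul_assoc, ← Complex.ofReal_mul,
        mul_inv_cancel₀ hp.ne', Complex.ofReal_one, one_mul]
    rw [setLIntegral_const, Real.volume_Ioo, sub_neg_eq_add, ← two_mul,
      restrict_Ioo_eq_restrict_Ioc]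
    calc ‖g z‖ₑ * ENNReal.ofReal (2 * Real.pi)
        = ‖((2 * Real.pi : ℝ) : ℂ) * g z‖ₑ := by
          rw [enorm_mul, mul_comm]
          congr 1
          rw [← ofReal_norm, Complex.norm_real, Real.norm_of_nonneg hp.le]
      _ ≤ _ := by
          rw [h2]
          exact enorm_integral_le_lintegral_enorm _
  have hF : Measurable ((ball (0 : ℂ) δ).indicator (fun w => ‖g (z + w)‖ₑ)) :=
    Measurable.indicator (by fun_prop) measurableSet_ball
  have hG : Measurable ((ball (0 : ℂ) δ).indicator (fun _ => ‖g z‖ₑ)) :=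
    Measurable.indicator (by fun_prop) measurableSet_ball
  have hpm : Measurable (fun p : ℝ × ℝ => Complex.polarCoord.symm p) := by
    simp_rw [Complex.polarCoord_symm_apply]
    fun_prop
  have main : ∫⁻ w, (ball (0 : ℂ) δ).indicator (fun _ => ‖g z‖ₑ) w ≤
      ∫⁻ w, (ball (0 : ℂ) δ).indicator (fun w => ‖g (z + w)‖ₑ) w := by
    rw [← Complex.lintegral_comp_polarCoord_symm, ← Complex.lintegral_comp_polarCoord_symm,
      polarCoord_target, Measure.volume_eq_prod, ← Measure.prod_restrict,
      lintegral_prod _ (by fun_prop), lintegral_prod _ (by fun_prop)]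
    refine setLIntegral_mono' measurableSet_Ioi (fun s hs => ?_)
    have hs0 : 0 < s := hs
    simp_rw [smul_eq_mul]
    rw [lintegral_const_mul _ (by fun_prop), lintegral_const_mul _ (by fun_prop)]
    refine mul_le_mul_right ?_ _
    by_cases hsd : s < δ
    · have hmem : ∀ θ : ℝ, Complex.polarCoord.symm (s, θ) ∈ ball (0 : ℂ) δ := by
        intro θ
        rw [mem_ball_zero_iff, Complex.norm_polarCoord_symm, abs_of_pos hs0]
        exact hsd
      have e : ∀ (h : ℂ → ℝ≥0∞) (θ : ℝ), (ball (0 : ℂ) δ).indicator h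
          (Complex.polarCoord.symm (s, θ)) = h (Complex.polarCoord.symm (s, θ)) :=
        fun h θ => indicator_of_mem (hmem θ) h
      simp only [e]
      exact key s ⟨hs0, hsd⟩
    · have hmem : ∀ θ : ℝ, Complex.polarCoord.symm (s, θ) ∉ ball (0 : ℂ) δ := by
        intro θ
        rw [mem_ball_zero_iff, Complex.norm_polarCoord_symm, abs_of_pos hs0]
        exact hsd
      have e : ∀ (h : ℂ → ℝ≥0∞) (θ : ℝ), (ball (0 : ℂ) δ).indicator h
          (Complex.polarCoord.symm (s, θ)) = 0 :=
        fun h θ => indicator_of_notMem (hmem θ) h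
      simp only [e, le_refl]
  rw [lintegral_indicator measurableSet_ball, setLIntegral_const] at main
  calc ‖g z‖ₑ * volume (ball z δ) = ‖g z‖ₑ * volume (ball (0 : ℂ) δ) := by
        rw [Measure.addHaar_ball_center]
    _ ≤ _ := main
    _ = ∫⁻ w, (ball z δ).indicator (fun w => ‖g w‖ₑ) (z + w) := by
        refine lintegral_congr (fun w => ?_)
        by_cases hw : ‖w‖ < δ
        · rw [indicator_of_mem (by simpa using hw), indicator_of_mem (by simpa using hw)]
        · rw [indicator_of_notMem (by simpa using hw), indicator_of_notMem (by simpa using hw)]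
    _ = _ := by
        rw [lintegral_add_left_eq_self (fun w => (ball z δ).indicator (fun w => ‖g w‖ₑ) w) z,
          lintegral_indicator measurableSet_ball]

theorem lintegral_enorm_sq_eq [Fact (-1 < α)] (f : BergmanSpace α) :
    ∫⁻ z, ‖f z ^ 2‖ₑ ∂weightedArea α = ENNReal.ofReal (‖f‖ ^ 2) := by
  rw [norm_sq_eq, ofReal_integral_eq_lintegral_ofReal (f.memLp.integrable_norm_pow (by simp))
    (ae_of_all _ (fun z => by positivity))]
  refine lintegral_congr (fun z => ?_)
  rw [← ofReal_norm, norm_pow]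

/-- Point evaluations are bounded, locally uniformly on the unit disk. -/
theorem exists_norm_le [hα : Fact (-1 < α)] {r : ℝ} (hr : r < 1) :
    ∃ C : ℝ, ∀ f : BergmanSpace α, ∀ z ∈ closedBall (0 : ℂ) r, ‖f z‖ ≤ C * ‖f‖ := by
  by_cases hr0 : 0 ≤ r
  swap
  · refine ⟨0, fun f z hz => ?_⟩
    simp [closedBall_eq_empty.2 (not_le.1 hr0)] at hz
  set δ : ℝ := (1 - r) / 2 with hδ
  have hδ0 : 0 < δ := by linarith
  -- the density is bounded below on the compact disk of radius `r + δ`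
  obtain ⟨m, hm0, hm⟩ : ∃ m : ℝ, 0 < m ∧ ∀ z ∈ closedBall (0 : ℂ) (r + δ),
      m ≤ weightConst α * Real.pi⁻¹ * (1 - ‖z‖ ^ 2) ^ α := by
    have hsub : closedBall (0 : ℂ) (r + δ) ⊆ unitDisk := closedBall_subset_ball (by linarith)
    obtain ⟨x, hx, hxm⟩ := (isCompact_closedBall (0 : ℂ) (r + δ)).exists_isMinOn
      (f := fun z => weightConst α * Real.pi⁻¹ * (1 - ‖z‖ ^ 2) ^ α)
      ⟨0, by simp; linarith⟩ (by
        refine continuousOn_const.mul (ContinuousOn.rpow_const (by fun_prop) (fun z hz => Or.inl ?_))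
        have h1 : ‖z‖ < 1 := by simpa [unitDisk] using hsub hz
        have h2 : 0 < 1 - ‖z‖ ^ 2 := by nlinarith [norm_nonneg z]
        exact h2.ne')
    exact ⟨_, density_pos (hsub hx), fun z hz => hxm hz⟩
  set V : ℝ := (volume (ball (0 : ℂ) δ)).toReal with hV
  have hVne : volume (ball (0 : ℂ) δ) ≠ ∞ := measure_ball_lt_top.ne
  have hV0 : 0 < V := ENNReal.toReal_pos (measure_ball_pos _ _ hδ0).ne' hVne
  have bound : ∀ f : BergmanSpace α, ∀ z ∈ closedBall (0 : ℂ) r, m * (‖f z‖ ^ 2 * V) ≤ ‖f‖ ^ 2 := by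
    intro f z hz
    have hz' : ‖z‖ ≤ r := by simpa using hz
    have hball : ball z δ ⊆ closedBall (0 : ℂ) (r + δ) := by
      intro w hw
      have hw' : ‖w - z‖ < δ := by simpa [dist_eq_norm] using hw
      have := norm_le_norm_add_norm_sub' w z
      simp only [mem_closedBall_zero_iff]
      linarith
    have hball' : ball z δ ⊆ unitDisk :=
      hball.trans (closedBall_subset_ball (by linarith))
    have h1 := enorm_mul_le_lintegral (g := fun w => f w ^ 2) (z := z) (δ := δ)
      (f.measurable.pow_const 2) ((f.differentiableOn.mono hball').pow 2)
    have h2 : ENNReal.ofReal m * ∫⁻ w in ball z δ, ‖f w ^ 2‖ₑ ≤ ENNReal.ofReal (‖f‖ ^ 2) := by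
      rw [← lintegral_enorm_sq_eq, weightedArea, lintegral_withDensity_eq_lintegral_mul _
        (by fun_prop) (f.measurable.pow_const 2).enorm,
        ← lintegral_const_mul _ (f.measurable.pow_const 2).enorm]
      calc ∫⁻ w in ball z δ, ENNReal.ofReal m * ‖f w ^ 2‖ₑ
          ≤ ∫⁻ w in ball z δ, ENNReal.ofReal
              (weightConst α * Real.pi⁻¹ * (1 - ‖w‖ ^ 2) ^ α) * ‖f w ^ 2‖ₑ := by
            refine setLIntegral_mono' measurableSet_ball (fun w hw => ?_)
            gcongr
            exact hm w (hball hw)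
        _ ≤ _ := lintegral_mono_set hball'
    have h3 : ENNReal.ofReal m * (‖f z ^ 2‖ₑ * volume (ball z δ)) ≤ ENNReal.ofReal (‖f‖ ^ 2) :=
      (mul_le_mul_right h1 _).trans h2
    rw [Measure.addHaar_ball_center, ← ENNReal.ofReal_toReal hVne, ← hV, ← ofReal_norm,
      ← ENNReal.ofReal_mul (by positivity), ← ENNReal.ofReal_mul hm0.le,
      ENNReal.ofReal_le_ofReal_iff (by positivity), norm_pow] at h3
    exact h3
  refine ⟨√((m * V)⁻¹), fun f z hz => ?_⟩
  refine le_of_sq_le_sq ?_ (by positivity)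
  rw [mul_pow, Real.sq_sqrt (by positivity), inv_mul_eq_div, le_div_iff₀ (by positivity)]
  linarith [bound f z hz]

/-- The element of `L²(dA_α)` given by an element of `A²_α`. -/
def toLp [Fact (-1 < α)] (f : BergmanSpace α) : Lp ℂ 2 (weightedArea α) := f.memLp.toLp f

theorem dist_toLp [Fact (-1 < α)] (f g : BergmanSpace α) : dist (toLp f) (toLp g) = dist f g := by
  rw [dist_eq_norm, dist_eq_norm, toLp, toLp, ← MemLp.toLp_sub]
  have h : MemLp.toLp _ (f.memLp.sub g.memLp) = toLp (f - g) := rfl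
  rw [h]
  refine (sq_eq_sq₀ (norm_nonneg _) (norm_nonneg _)).1 ?_
  rw [norm_sq_eq]
  have h2 := inner_self_eq_norm_sq_to_K (𝕜 := ℂ) (toLp (f - g))
  rw [L2.inner_def] at h2
  refine Complex.ofReal_injective ?_
  rw [← integral_complex_ofReal]
  have h3 : ((‖toLp (f - g)‖ ^ 2 : ℝ) : ℂ) = (‖toLp (f - g)‖ : ℂ) ^ 2 := by push_cast; rfl
  rw [h3]
  refine h2.symm.trans (integral_congr_ae ?_)
  filter_upwards [(f - g).memLp.coeFn_toLp] with z hz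
  rw [toLp, hz, inner_self_eq_norm_sq_to_K]
  simp

/-- `A²_α` is complete, hence a Hilbert space. -/
instance [hα : Fact (-1 < α)] : CompleteSpace (BergmanSpace α) := by
  classical
  refine Metric.complete_of_cauchySeq_tendsto (fun u hu => ?_)
  -- the limit in `L²`
  have hL : CauchySeq (fun n => toLp (u n)) := by
    rw [Metric.cauchySeq_iff] at hu ⊢
    simpa only [dist_toLp] using hu
  obtain ⟨F, hF⟩ := cauchySeq_tendsto_of_complete hL
  -- the pointwise limit
  have hunif : ∀ r < 1, UniformCauchySeqOn (fun n => (u n : ℂ → ℂ)) atTop (closedBall (0 : ℂ) r) := by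
    intro r hr
    obtain ⟨C, hC⟩ := exists_norm_le (α := α) hr
    rw [Metric.uniformCauchySeqOn_iff]
    intro ε hε
    obtain ⟨N, hN⟩ := Metric.cauchySeq_iff.1 hu (ε / (|C| + 1)) (by positivity)
    refine ⟨N, fun m hm n hn z hz => ?_⟩
    have h1 := hC (u m - u n) z hz
    have h2 := hN m hm n hn
    rw [dist_eq_norm] at h2 ⊢
    rw [lt_div_iff₀ (by positivity)] at h2
    rw [sub_apply] at h1
    nlinarith [le_abs_self C, norm_nonneg (u m - u n)]
  have hlim : ∀ z : ℂ, ∃ l, Tendsto (fun n => u n z) atTop (𝓝 l) := by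
    intro z
    by_cases hz : z ∈ unitDisk
    · have hz1 : ‖z‖ < 1 := by simpa [unitDisk] using hz
      exact cauchySeq_tendsto_of_complete ((hunif _ hz1).cauchySeq (by simp))
    · exact ⟨0, by simp [eq_zero_of_notMem _ hz]⟩
  choose g hg using hlim
  have hgd : DifferentiableOn ℂ g unitDisk := by
    have hloc : TendstoLocallyUniformlyOn (fun n => (u n : ℂ → ℂ)) g atTop unitDisk := by
      rw [tendstoLocallyUniformlyOn_iff_forall_isCompact isOpen_unitDisk]
      intro K hK hKc
      obtain ⟨r, hr1, hKr⟩ : ∃ r < 1, K ⊆ closedBall (0 : ℂ) r := by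
        obtain ⟨r, hr, hr'⟩ := exists_lt_subset_ball hKc.isClosed hK
        exact ⟨r, hr, hr'.trans ball_subset_closedBall⟩
      exact ((hunif r hr1).tendstoUniformlyOn_of_tendsto (fun z _ => hg z)).mono hKr
    exact hloc.differentiableOn (Eventually.of_forall (fun n => (u n).differentiableOn))
      isOpen_unitDisk
  -- the two limits agree
  have hae : F =ᵐ[weightedArea α] g := by
    have hmeas : TendstoInMeasure (weightedArea α) (fun n => (toLp (u n) : ℂ → ℂ)) atTop F :=
      tendstoInMeasure_of_tendsto_Lp hF
    obtain ⟨ns, hns, hae⟩ := hmeas.exists_seq_tendsto_ae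
    have hrep : ∀ᵐ z ∂weightedArea α, ∀ n, toLp (u n) z = u n z :=
      ae_all_iff.2 (fun n => (u n).memLp.coeFn_toLp)
    filter_upwards [hae, hrep] with z h1 h2
    simp_rw [h2] at h1
    exact tendsto_nhds_unique h1 ((hg z).comp hns.tendsto_atTop)
  have hgL : MemLp g 2 (weightedArea α) := (Lp.memLp F).ae_eq hae
  let G : BergmanSpace α := ⟨g, (mem_bergman_iff_of_neg_one_lt hα.out).2 ⟨hgd, fun z hz =>
    tendsto_nhds_unique (hg z) (by simp [eq_zero_of_notMem _ hz]), hgL⟩⟩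
  have hG : toLp G = F := by
    refine Lp.ext ?_
    exact (MemLp.coeFn_toLp _).trans hae.symm
  refine ⟨G, ?_⟩
  rw [tendsto_iff_dist_tendsto_zero] at hF ⊢
  rw [← hG] at hF
  simpa only [dist_toLp] using hF

end BergmanSpace

/-- Membership in the closed unit ball of `H^∞`: `φ` is holomorphic on the unit disk and
`|φ| ≤ 1` there. The values of `φ` outside the disk play no role. -/
structure MemHInftyUnitBall (φ : ℂ → ℂ) : Prop where
  differentiableOn : DifferentiableOn ℂ φ unitDisk
  norm_le_one : ∀ z ∈ unitDisk, ‖φ z‖ ≤ 1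

/-- On the unit disk, `φ` is a finite Blaschke product
`ζ ∏ (z - a i) / (1 - conj (a i) z)` with `|ζ| = 1` and `|a i| < 1`. -/
def IsFiniteBlaschkeProduct (φ : ℂ → ℂ) : Prop :=
  ∃ (n : ℕ) (a : Fin n → ℂ) (ζ : ℂ), ‖ζ‖ = 1 ∧ (∀ i, a i ∈ unitDisk) ∧
    ∀ z ∈ unitDisk, φ z = ζ * ∏ i, (z - a i) / (1 - conj (a i) * z)

namespace BergmanSpace

variable {α : ℝ}

/-- The product of a function in the unit ball of `H^∞` and an element of `A²_α`. -/
def mul [hα : Fact (-1 < α)] {φ : ℂ → ℂ} (hφ : MemHInftyUnitBall φ) (f : BergmanSpace α) :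
    BergmanSpace α :=
  ⟨fun z => φ z * f z, (mem_bergman_iff_of_neg_one_lt hα.out).2
    ⟨hφ.differentiableOn.mul f.differentiableOn,
      fun z hz => by simp [f.eq_zero_of_notMem hz], by
      classical
      have hm : Measurable (fun z => φ z * f z) := by
        have h : (fun z => φ z * f z) = unitDisk.piecewise (fun z => φ z * f z) 0 := by
          ext z
          by_cases hz : z ∈ unitDisk
          · simp [hz]
          · simp [hz, f.eq_zero_of_notMem hz]
        rw [h]
        exact (hφ.differentiableOn.mul f.differentiableOn).continuousOn.measurable_piecewise
          continuousOn_const isOpen_unitDisk.measurableSet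
      refine f.memLp.mono hm.aestronglyMeasurable ?_
      filter_upwards [ae_mem_unitDisk α] with z hz
      rw [norm_mul]
      exact mul_le_of_le_one_left (norm_nonneg _) (hφ.norm_le_one z hz)⟩⟩

@[simp] theorem mul_apply [Fact (-1 < α)] {φ : ℂ → ℂ} (hφ : MemHInftyUnitBall φ)
    (f : BergmanSpace α) (z : ℂ) : mul hφ f z = φ z * f z := rfl

theorem norm_mul_le [Fact (-1 < α)] {φ : ℂ → ℂ} (hφ : MemHInftyUnitBall φ)
    (f : BergmanSpace α) : ‖mul hφ f‖ ≤ ‖f‖ := by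
  refine le_of_sq_le_sq ?_ (norm_nonneg _)
  rw [norm_sq_eq, norm_sq_eq]
  refine integral_mono_ae ((mul hφ f).memLp.integrable_norm_pow (by simp))
    (f.memLp.integrable_norm_pow (by simp)) ?_
  filter_upwards [ae_mem_unitDisk α] with z hz
  rw [mul_apply, norm_mul]
  gcongr
  exact mul_le_of_le_one_left (norm_nonneg _) (hφ.norm_le_one z hz)

/-- The multiplication operator `T_φ f = φ f` on `A²_α`. -/
def T (α : ℝ) [Fact (-1 < α)] {φ : ℂ → ℂ} (hφ : MemHInftyUnitBall φ) :
    BergmanSpace α →L[ℂ] BergmanSpace α :=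
  LinearMap.mkContinuous
    { toFun := mul hφ
      map_add' := fun f g => by ext z; simp [mul_add]
      map_smul' := fun c f => by ext z; simp [mul_left_comm] }
    1 (fun f => by simpa using norm_mul_le hφ f)

@[simp] theorem T_apply [Fact (-1 < α)] {φ : ℂ → ℂ} (hφ : MemHInftyUnitBall φ)
    (f : BergmanSpace α) (z : ℂ) : T α hφ f z = φ z * f z := rfl

/-- The operator `E_φ = I - T_φ T_φ^*` on `A²_α`. -/
def E (α : ℝ) [Fact (-1 < α)] {φ : ℂ → ℂ} (hφ : MemHInftyUnitBall φ) :
    BergmanSpace α →L[ℂ] BergmanSpace α :=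
  ContinuousLinearMap.id ℂ (BergmanSpace α) - T α hφ ∘L ContinuousLinearMap.adjoint (T α hφ)

/-- The range of `E_φ`, as a set of functions on the disk. -/
def rangeE (α : ℝ) [Fact (-1 < α)] {φ : ℂ → ℂ} (hφ : MemHInftyUnitBall φ) : Set (ℂ → ℂ) :=
  Set.range (fun f : BergmanSpace α => (E α hφ f : ℂ → ℂ))

end BergmanSpace

end

noncomputable section

/-! Everything is compared with P = I - T_z T_z^*, the defect operator of the shift. The monomials
are orthogonal in A²_α with squared norms given by a Beta function, and P is diagonal: it multiplies
the n-th Taylor coefficient by (1+α)/(n+1+α) (`taylorCoeff_shiftDefect`). Hence P is compact and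
injective, and its range is A²_{α-2} (`range_shiftDefect`), because passing from A²_α to A²_{α-2}
costs exactly a factor of order n² in the squared norm of z^n. Under (d), E_φ therefore factors as P
C with C linear; the closed graph theorem makes C bounded, and (a) follows.

For (a) ⇒ (b), normalized reproducing kernels k_w tend weakly to zero as |w| → 1. The kernels are
eigenvectors of T_φ^*, so ⟨E_φ k_w, k_w⟩ = 1 - |φ(w)|², and compactness forces |φ| → 1 at the
circle. Dividing out zeros and applying the maximum principle shows that such a function is a finite
Blaschke product (`isFiniteBlaschkeProduct_of_tendsto`).

The heart is (b) ⇒ (c). For a Blaschke factor b with zero a, E_b = (1-|a|²) M P M^*, where M is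
multiplication by 1/(1 - conj(a) z) (`defect_blaschkeFactor`). The inverse of P is the first order
differential operator 1 + (1+α)⁻¹ z d/dz, so the Leibniz rule gives M_g P = P (M_g + compact)
whenever g and g' are bounded (`multiplier_comp_shiftDefect`). Together with E_{bψ} = E_b + M_b E_ψ
M_b^*, induction on the number of factors gives E_φ = P (A + K) with K compact and A coercive once
there is at least one factor (`E_blaschkeFactor_mul`). Since |φ| < 1 in the disk, E_φ is injective,
hence so is A + K. By the Fredholm alternative A + K is onto, and E_φ has the range of P. -/

/-- The additive group structure underlying the Hilbert space structure of `A²_α`. Using it (and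
the module structure below) locally makes the instances in terms mixing algebra and topology
syntactically equal. -/
abbrev BergmanSpace.addCommGroupOfHilbert {α : ℝ} [Fact (-1 < α)] : AddCommGroup (BergmanSpace α) :=
  NormedAddCommGroup.toAddCommGroup

attribute [local instance] BergmanSpace.addCommGroupOfHilbert

/-- The module structure underlying the Hilbert space structure of `A²_α`. -/
abbrev BergmanSpace.moduleOfHilbert {α : ℝ} [Fact (-1 < α)] : Module ℂ (BergmanSpace α) :=
  NormedSpace.toModule

attribute [local instance] BergmanSpace.moduleOfHilbert

/-! ### Taylor coefficients on the disk -/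

/-- The `n`-th Taylor coefficient of `f` at the origin. -/
def taylorCoeff (f : ℂ → ℂ) (n : ℕ) : ℂ := iteratedDeriv n f 0 / n.factorial

theorem mem_unitDisk {z : ℂ} : z ∈ unitDisk ↔ ‖z‖ < 1 := by simp [unitDisk]

theorem hasSum_taylorCoeff {f : ℂ → ℂ} (hf : DifferentiableOn ℂ f unitDisk) {z : ℂ}
    (hz : z ∈ unitDisk) : HasSum (fun n => taylorCoeff f n * z ^ n) (f z) := by
  have h := Complex.hasSum_taylorSeries_on_ball hf hz
  simp only [smul_eq_mul, sub_zero] at h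
  have h' : (fun n => taylorCoeff f n * z ^ n) =
      fun n : ℕ => (n.factorial : ℂ)⁻¹ * (z ^ n * iteratedDeriv n f 0) := by
    funext n
    rw [taylorCoeff]
    ring
  rw [h']
  exact h

/-- Analyticity is not assumed: convergence at every real r < 1 makes c_n r^n tend to 0, so the
radius of convergence is at least 1. This is how coefficients are read off from functional
identities below. -/
theorem taylorCoeff_eq_of_hasSum {f : ℂ → ℂ} {c : ℕ → ℂ}
    (hc : ∀ z ∈ unitDisk, HasSum (fun n => c n * z ^ n) (f z)) (n : ℕ) :
    taylorCoeff f n = c n := by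
  have h1 : HasFPowerSeriesOnBall f (FormalMultilinearSeries.ofScalars ℂ c) 0 1 := by
    refine ⟨?_, by norm_num, ?_⟩
    · refine ENNReal.le_of_forall_nnreal_lt (fun r hr => ?_)
      have hr' : (r : ℝ) < 1 := by exact_mod_cast hr
      have := hc (r : ℂ) (by simpa [mem_unitDisk] using hr')
      refine FormalMultilinearSeries.le_radius_of_tendsto _ (l := 0) ?_
      have h2 := this.summable.tendsto_atTop_zero.norm
      simpa [FormalMultilinearSeries.ofScalars_norm] using h2
    · intro y hy
      have hy' : y ∈ unitDisk := by
        rw [mem_unitDisk]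
        simpa [enorm_eq_nnnorm, ← NNReal.coe_lt_coe] using hy
      simpa [FormalMultilinearSeries.ofScalars_apply_eq, zero_add, mul_comm] using hc y hy'
  have hd : DifferentiableOn ℂ f unitDisk := by
    have := h1.differentiableOn
    refine this.mono (fun y hy => ?_)
    rw [mem_unitDisk] at hy
    simpa [enorm_eq_nnnorm, ← NNReal.coe_lt_coe] using hy
  have h2 := h1.factorial_smul 1 n
  rw [iteratedFDeriv_apply_eq_iteratedDeriv_mul_prod] at h2
  simp at h2
  rw [taylorCoeff, ← h2, mul_div_cancel_left₀ _ (by exact_mod_cast n.factorial_ne_zero)]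

theorem taylorCoeff_congr {f g : ℂ → ℂ} (h : EqOn f g unitDisk) (n : ℕ) :
    taylorCoeff f n = taylorCoeff g n := by
  have : f =ᶠ[𝓝 0] g := h.eventuallyEq_of_mem (isOpen_unitDisk.mem_nhds (by simp [mem_unitDisk]))
  rw [taylorCoeff, taylorCoeff, this.iteratedDeriv_eq]

theorem integral_circle_taylorCoeff {f : ℂ → ℂ} (hf : DifferentiableOn ℂ f unitDisk) (n : ℕ)
    {r : ℝ} (hr : 0 < r) (hr1 : r < 1) :
    ∫ θ in Ioo (-Real.pi) Real.pi, conj (circleMap 0 r θ) ^ n * f (circleMap 0 r θ) =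
      2 * Real.pi * r ^ (2 * n) * taylorCoeff f n := by
  have hd : DiffContOnCl ℂ f (ball 0 r) := by
    refine DifferentiableOn.diffContOnCl ?_
    rw [closure_ball _ hr.ne']
    exact hf.mono (closedBall_subset_ball hr1)
  have h1 := hd.circleIntegral_one_div_sub_center_pow_smul hr n
  have h2 : Real.circleAverage (fun z => conj z ^ n * f z) 0 r = r ^ (2 * n) * taylorCoeff f n := by
    rw [Real.circleAverage_eq_circleIntegral hr.ne']
    -- On the circle |z| = r one has conj z = r²/z, which turns the integrand into the one of
    -- Cauchy's coefficient formula.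
    have h3 : EqOn (fun z => (z - 0)⁻¹ • (conj z ^ n * f z))
        (fun z => (r : ℂ) ^ (2 * n) * ((1 / (z - 0) ^ (n + 1)) • f z)) (sphere 0 r) := by
      intro z hz
      have hz' : ‖z‖ = r := by simpa using hz
      have hz0 : z ≠ 0 := by
        rw [← norm_pos_iff, hz']
        exact hr
      have hc : conj z = r ^ 2 / z := by
        rw [eq_div_iff hz0, Complex.conj_mul', hz']
      simp only [sub_zero, hc, smul_eq_mul, div_pow, ← pow_mul]
      field_simp
      ring
    rw [circleIntegral.integral_congr hr.le h3, circleIntegral.integral_const_mul, h1, taylorCoeff]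
    simp only [smul_eq_mul]
    field_simp
  rw [Real.circleAverage_eq_integral_add (-Real.pi),
      intervalIntegral.integral_comp_add_right (fun θ => conj (circleMap 0 r θ) ^ n * f (circleMap 0 r θ)),
      zero_add, show 2 * Real.pi + -Real.pi = Real.pi by ring,
      intervalIntegral.integral_of_le (by linarith [Real.pi_pos])] at h2
  rw [← restrict_Ioo_eq_restrict_Ioc] at h2
  rw [mul_assoc, ← h2, Complex.real_smul, ← mul_assoc]
  push_cast
  rw [mul_inv_cancel₀ (by simp [Real.pi_ne_zero]), one_mul]

/-! ### Norms of monomials and radial integrals -/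

/-- The square of the norm of `z ^ n` in `A²_γ`. -/
def bergmanWeight (γ : ℝ) (n : ℕ) : ℝ := (γ + 1) * ProbabilityTheory.beta (n + 1) (γ + 1)

theorem bergmanWeight_pos {γ : ℝ} (h : -1 < γ) (n : ℕ) : 0 < bergmanWeight γ n :=
  mul_pos (by linarith) (ProbabilityTheory.beta_pos (by positivity) (by linarith))

theorem bergmanWeight_zero {γ : ℝ} (h : -1 < γ) : bergmanWeight γ 0 = 1 := by
  have h1 : 0 < Real.Gamma (γ + 1) := Real.Gamma_pos_of_pos (by linarith)
  have h2 : γ + 1 ≠ 0 := by linarith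
  rw [bergmanWeight, ProbabilityTheory.beta, Nat.cast_zero, zero_add, Real.Gamma_one,
    add_comm 1 (γ + 1), Real.Gamma_add_one h2]
  field_simp

/-- The functional equation of Gamma. This ratio of consecutive weights determines the eigenvalues
of the shift defect. -/
theorem bergmanWeight_succ {γ : ℝ} (h : -1 < γ) (n : ℕ) :
    (n + 2 + γ) * bergmanWeight γ (n + 1) = (n + 1) * bergmanWeight γ n := by
  have h2 : (n : ℝ) + 2 + γ ≠ 0 := by
    have : (0 : ℝ) ≤ n := n.cast_nonneg
    linarith
  have h3 : (n : ℝ) + 1 ≠ 0 := by positivity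
  have h1 : 0 < Real.Gamma (n + 2 + γ) := Real.Gamma_pos_of_pos (by
    have : (0 : ℝ) ≤ n := n.cast_nonneg
    linarith)
  rw [bergmanWeight, bergmanWeight, ProbabilityTheory.beta, ProbabilityTheory.beta]
  push_cast
  rw [Real.Gamma_add_one h3, show (n : ℝ) + 1 + 1 + (γ + 1) = n + 2 + γ + 1 by ring,
    show (n : ℝ) + 1 + (γ + 1) = n + 2 + γ by ring, Real.Gamma_add_one h2]
  field_simp

/-- Lowering the exponent by 2 multiplies the weights by a factor of order n². This identifies
A²_{α-2} when α > 1, where no derivative enters its definition. -/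
theorem bergmanWeight_sub_two {γ : ℝ} (h : 1 < γ) (n : ℕ) :
    (n + γ) * (n + 1 + γ) * bergmanWeight γ n = γ * (γ + 1) * bergmanWeight (γ - 2) n := by
  induction n with
  | zero => simp [bergmanWeight_zero (show -1 < γ by linarith), bergmanWeight_zero (show -1 < γ - 2 by linarith), add_comm]
  | succ n ih =>
    have h1 := bergmanWeight_succ (show -1 < γ by linarith) n
    have h2 := bergmanWeight_succ (show -1 < γ - 2 by linarith) n
    have h3 : (n : ℝ) + γ ≠ 0 := by
      have : (0 : ℝ) ≤ n := n.cast_nonneg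
      linarith
    push_cast
    have h4 : ((n : ℝ) + γ) * (((n : ℝ) + 1 + γ) * (n + 1 + 1 + γ) * bergmanWeight γ (n + 1)) =
      (n + γ) * (γ * (γ + 1) * bergmanWeight (γ - 2) (n + 1)) := by
      linear_combination (n + γ) * (n + 1 + γ) * h1 + (n + 1) * ih - γ * (γ + 1) * h2
    exact mul_left_cancel₀ h3 h4

theorem bergmanWeight_succ_le {γ : ℝ} (h : -1 < γ) (n : ℕ) :
    bergmanWeight γ (n + 1) ≤ bergmanWeight γ n := by
  have h1 := bergmanWeight_succ h n
  have h2 := bergmanWeight_pos h (n + 1)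
  have : (0 : ℝ) ≤ n := n.cast_nonneg
  nlinarith

theorem bergmanWeight_le_one {γ : ℝ} (h : -1 < γ) (n : ℕ) : bergmanWeight γ n ≤ 1 := by
  rw [← bergmanWeight_zero h]
  exact antitone_nat_of_succ_le (bergmanWeight_succ_le h) n.zero_le

/-- The substitution t = r² turns this into a Beta integral. -/
theorem integral_radial {γ : ℝ} (h : -1 < γ) (n : ℕ) :
    ∫ r in Ioi (0 : ℝ), (Ioo (0 : ℝ) 1).indicator
      (fun r => 2 * (γ + 1) * (r * (1 - r ^ 2) ^ γ * r ^ (2 * n))) r = bergmanWeight γ n := by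
  rw [bergmanWeight, ProbabilityTheory.beta_eq_betaIntegralReal _ _ (by positivity) (by linarith)]
  have h1 := integral_comp_rpow_Ioi_of_pos (p := 2) two_pos
    (g := (Ioo (0 : ℝ) 1).indicator (fun t : ℝ => (γ + 1) * (t ^ n * (1 - t) ^ γ)))
  have h2 : ∫ y in Ioi 0, (Ioo (0 : ℝ) 1).indicator (fun t : ℝ => (γ + 1) * (t ^ n * (1 - t) ^ γ)) y
      = (γ + 1) * ∫ t in Ioo (0 : ℝ) 1, t ^ n * (1 - t) ^ γ := by
    rw [setIntegral_indicator measurableSet_Ioo, integral_const_mul]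
    congr 2
    rw [inter_eq_right.2 (fun x hx => hx.1)]
  have h3 : ∫ t in Ioo (0 : ℝ) 1, t ^ n * (1 - t) ^ γ =
      (Complex.betaIntegral ((n + 1 : ℝ) : ℂ) ((γ + 1 : ℝ) : ℂ)).re := by
    rw [Complex.betaIntegral, intervalIntegral.integral_of_le zero_le_one,
      ← restrict_Ioo_eq_restrict_Ioc]
    have : ∫ x : ℝ in Ioo 0 1, (x : ℂ) ^ (((n + 1 : ℝ) : ℂ) - 1) * (1 - (x : ℂ)) ^ (((γ + 1 : ℝ) : ℂ) - 1) =
        ∫ x : ℝ in Ioo 0 1, ((x ^ n * (1 - x) ^ γ : ℝ) : ℂ) := by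
      refine setIntegral_congr_fun measurableSet_Ioo (fun x hx => ?_)
      have hx1 : 0 ≤ 1 - x := by linarith [hx.2]
      push_cast
      rw [add_sub_cancel_right, add_sub_cancel_right, Complex.cpow_natCast,
        Complex.ofReal_cpow hx1]
      push_cast
      rfl
    rw [this, integral_complex_ofReal, Complex.ofReal_re]
  rw [← h3, ← h2, ← h1]
  refine setIntegral_congr_fun measurableSet_Ioi (fun r hr => ?_)
  have hr0 : 0 < r := hr
  by_cases hr1 : r < 1
  · rw [indicator_of_mem (show r ∈ Ioo 0 1 from ⟨hr0, hr1⟩), indicator_of_mem]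
    · simp only [Real.rpow_two, smul_eq_mul, show (2 : ℝ) - 1 = 1 by norm_num, Real.rpow_one, pow_mul]
      ring
    · rw [Real.rpow_two]
      exact ⟨by positivity, by nlinarith⟩
  · rw [indicator_of_notMem (fun hh => hr1 hh.2), indicator_of_notMem, smul_zero]
    rw [Real.rpow_two]
    exact fun hh => hr1 (by nlinarith [hh.2])

/-- Integration in polar coordinates, as an iterated integral. -/
theorem Complex.integral_eq_integral_polar {g : ℂ → ℂ} (hg : Integrable g) (hgm : Measurable g) :
    ∫ z, g z = ∫ r in Ioi (0 : ℝ), ∫ θ in Ioo (-Real.pi) Real.pi, (r : ℂ) * g (circleMap 0 r θ) := by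
  have hpol : ∀ p : ℝ × ℝ, Complex.polarCoord.symm p = circleMap 0 p.1 p.2 := by
    intro p
    simp [circleMap, Complex.exp_mul_I]
  have hpm : Measurable (fun p : ℝ × ℝ => circleMap 0 p.1 p.2) := by
    unfold circleMap
    fun_prop
  have hi : IntegrableOn (fun p : ℝ × ℝ => (p.1 : ℂ) * g (circleMap 0 p.1 p.2)) polarCoord.target := by
    refine ⟨by fun_prop, ?_⟩
    have h1 := Complex.lintegral_comp_polarCoord_symm (fun z => ‖g z‖ₑ)
    have h2 : ∫⁻ p in polarCoord.target, ‖(p.1 : ℂ) * g (circleMap 0 p.1 p.2)‖ₑ = ∫⁻ z, ‖g z‖ₑ := by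
      rw [← h1]
      refine setLIntegral_congr_fun polarCoord.open_target.measurableSet (fun p hp => ?_)
      simp only [hpol, enorm_mul, smul_eq_mul]
      congr 1
      rw [← ofReal_norm, Complex.norm_real, Real.norm_of_nonneg (le_of_lt hp.1)]
    rw [hasFiniteIntegral_iff_enorm, h2]
    exact hg.2
  rw [← Complex.integral_comp_polarCoord_symm]
  simp only [hpol, Complex.real_smul]
  rw [polarCoord_target] at hi ⊢
  rw [Measure.volume_eq_prod] at hi ⊢
  exact setIntegral_prod _ hi

theorem isFiniteMeasure_weightedArea {γ : ℝ} (h : -1 < γ) :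
    IsFiniteMeasure (weightedArea γ) := by
  have h1 : IntegrableOn ((Ioo (0 : ℝ) 1).indicator
      (fun r => 2 * (γ + 1) * (r * (1 - r ^ 2) ^ γ * r ^ (2 * 0)))) (Ioi (0 : ℝ)) := by
    -- The integral of a nonintegrable function is 0 by convention, so the value 1 already proves
    -- integrability.
    refine not_imp_comm.1 integral_undef ?_
    rw [integral_radial h, bergmanWeight_zero h]
    exact one_ne_zero
  have h2 : IntegrableOn (fun z : ℂ => weightConst γ * Real.pi⁻¹ * (1 - ‖z‖ ^ 2) ^ γ) unitDisk := by
    refine (integrableOn_fun_norm_addHaar (volume : Measure ℂ)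
      (f := fun r => weightConst γ * Real.pi⁻¹ * (1 - r ^ 2) ^ γ)).2 ?_
    refine IntegrableOn.congr_fun ((h1.mono_set (fun r hr => hr.1)).const_mul (Real.pi⁻¹ / 2))
      (fun r hr => ?_) measurableSet_Ioo
    rw [indicator_of_mem hr, weightConst, if_pos h]
    simp
    ring
  exact isFiniteMeasure_withDensity_ofReal h2.2

/-! ### The orthonormal basis of monomials -/

namespace BergmanSpace

variable {α : ℝ}

/-- The monomial `z ^ n` as an element of `A²_α`. -/
def monomial (α : ℝ) [hα : Fact (-1 < α)] (n : ℕ) : BergmanSpace α :=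
  ⟨unitDisk.indicator (fun z => z ^ n), (mem_bergman_iff_of_neg_one_lt hα.out).2 ⟨by
    refine DifferentiableOn.congr (f := fun z => z ^ n) (by fun_prop) (fun z hz => ?_)
    exact indicator_of_mem hz _, fun z hz => indicator_of_notMem hz _, by
    have hfin : IsFiniteMeasure (weightedArea α) := isFiniteMeasure_weightedArea hα.out
    refine MemLp.of_bound (C := 1) ?_ ?_
    · exact ((continuous_pow n).measurable.indicator
        isOpen_unitDisk.measurableSet).aestronglyMeasurable
    · filter_upwards [ae_mem_unitDisk α] with z hz
      rw [indicator_of_mem hz, norm_pow]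
      exact pow_le_one₀ (norm_nonneg _) (mem_unitDisk.1 hz).le⟩⟩

theorem monomial_apply [Fact (-1 < α)] (n : ℕ) {z : ℂ} (hz : z ∈ unitDisk) :
    monomial α n z = z ^ n := indicator_of_mem hz _

theorem taylorCoeff_monomial [Fact (-1 < α)] (m n : ℕ) :
    taylorCoeff (monomial α m) n = if n = m then 1 else 0 := by
  refine taylorCoeff_eq_of_hasSum (c := fun n => if n = m then 1 else 0) (fun z hz => ?_) n
  rw [monomial_apply m hz]
  convert hasSum_ite_eq m (z ^ m) using 2 with k
  split_ifs with h <;> simp [h]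

theorem inner_monomial [hα : Fact (-1 < α)] (n : ℕ) (f : BergmanSpace α) :
    inner ℂ (monomial α n) f = bergmanWeight α n * taylorCoeff f n := by
  have hint := integrable_conj_mul (monomial α n) f
  have hmeas : Measurable fun z : ℂ => weightConst α * Real.pi⁻¹ * (1 - ‖z‖ ^ 2) ^ α := by fun_prop
  have hnn : ∀ z ∈ unitDisk, 0 ≤ weightConst α * Real.pi⁻¹ * (1 - ‖z‖ ^ 2) ^ α :=
    fun z hz => (density_pos hz).le
  have e1 : ∀ z ∈ unitDisk,
      (ENNReal.ofReal (weightConst α * Real.pi⁻¹ * (1 - ‖z‖ ^ 2) ^ α)).toReal •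
        (conj (monomial α n z) * f z) =
      ((weightConst α * Real.pi⁻¹ * (1 - ‖z‖ ^ 2) ^ α : ℝ) : ℂ) * (conj z ^ n * f z) := by
    intro z hz
    rw [ENNReal.toReal_ofReal (hnn z hz), Complex.real_smul, monomial_apply n hz, map_pow]
  -- The weighted integrand, extended by zero to the plane so that polar coordinates apply. On each
  -- circle the angular integral then extracts one Taylor coefficient.
  set g : ℂ → ℂ := unitDisk.indicator
    (fun z => ((weightConst α * Real.pi⁻¹ * (1 - ‖z‖ ^ 2) ^ α : ℝ) : ℂ) * (conj z ^ n * f z)) with hg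
  have hgm : Measurable g := by
    refine Measurable.indicator ?_ isOpen_unitDisk.measurableSet
    have := f.measurable
    fun_prop
  have hgi : Integrable g := by
    rw [weightedArea, integrable_withDensity_iff_integrable_smul₀' (by fun_prop) (by simp)] at hint
    refine (integrable_indicator_iff isOpen_unitDisk.measurableSet).2 ?_
    exact (integrableOn_congr_fun e1 isOpen_unitDisk.measurableSet).1 hint
  have h1 : inner ℂ (monomial α n) f = ∫ z, g z := by
    rw [inner_def, weightedArea, integral_withDensity_eq_integral_toReal_smul₀ (by fun_prop) (by simp),
      setIntegral_congr_fun isOpen_unitDisk.measurableSet e1, ← integral_indicator isOpen_unitDisk.measurableSet]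
  rw [h1, Complex.integral_eq_integral_polar hgi hgm, ← integral_radial hα.out, ← integral_complex_ofReal,
    ← integral_mul_const]
  refine setIntegral_congr_fun measurableSet_Ioi (fun r hr => ?_)
  have hr0 : 0 < r := hr
  by_cases hr1 : r < 1
  · have hmem : ∀ θ, circleMap 0 r θ ∈ unitDisk := fun θ => by
      rw [mem_unitDisk, norm_circleMap_zero, abs_of_pos hr0]; exact hr1
    have e2 : ∀ θ, (r : ℂ) * g (circleMap 0 r θ) =
        ((r * (weightConst α * Real.pi⁻¹ * (1 - r ^ 2) ^ α) : ℝ) : ℂ) *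
        (conj (circleMap 0 r θ) ^ n * f (circleMap 0 r θ)) := fun θ => by
      rw [hg, indicator_of_mem (hmem θ), norm_circleMap_zero, abs_of_pos hr0]
      push_cast
      ring
    simp only [e2]
    rw [integral_const_mul, integral_circle_taylorCoeff f.differentiableOn n hr0 hr1,
      indicator_of_mem (show r ∈ Ioo 0 1 from ⟨hr0, hr1⟩), weightConst, if_pos hα.out]
    have := Real.pi_ne_zero
    push_cast
    field_simp
  · have hmem : ∀ θ, circleMap 0 r θ ∉ unitDisk := fun θ => by
      rw [mem_unitDisk, norm_circleMap_zero, abs_of_pos hr0]; exact hr1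
    have e2 : ∀ θ, (r : ℂ) * g (circleMap 0 r θ) = 0 := fun θ => by
      rw [hg, indicator_of_notMem (hmem θ), mul_zero]
    simp only [e2, integral_zero]
    rw [indicator_of_notMem (fun hh => hr1 hh.2)]
    simp

theorem ext_taylorCoeff {f g : BergmanSpace α} (h : ∀ n, taylorCoeff f n = taylorCoeff g n) :
    f = g := by
  ext z
  by_cases hz : z ∈ unitDisk
  · refine (hasSum_taylorCoeff f.differentiableOn hz).unique ?_
    simp_rw [h]
    exact hasSum_taylorCoeff g.differentiableOn hz
  · rw [f.eq_zero_of_notMem hz, g.eq_zero_of_notMem hz]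

theorem inner_monomial_monomial [Fact (-1 < α)] (m n : ℕ) :
    inner ℂ (monomial α m) (monomial α n) = if m = n then (bergmanWeight α m : ℂ) else 0 := by
  rw [inner_monomial, taylorCoeff_monomial]
  simp

/-- The normalized monomials. -/
def unitMonomial (α : ℝ) [Fact (-1 < α)] (n : ℕ) : BergmanSpace α :=
  (((√(bergmanWeight α n))⁻¹ : ℝ) : ℂ) • monomial α n

theorem inner_unitMonomial [hα : Fact (-1 < α)] (n : ℕ) (f : BergmanSpace α) :
    inner ℂ (unitMonomial α n) f = √(bergmanWeight α n) * taylorCoeff f n := by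
  have h := bergmanWeight_pos hα.out n
  rw [unitMonomial, inner_smul_left, inner_monomial, Complex.conj_ofReal, ← mul_assoc,
    ← Complex.ofReal_mul, inv_mul_eq_div, Real.div_sqrt]

theorem orthonormal_unitMonomial [hα : Fact (-1 < α)] : Orthonormal ℂ (unitMonomial α) := by
  rw [orthonormal_iff_ite]
  intro m n
  have h := Real.sqrt_pos.2 (bergmanWeight_pos hα.out n)
  rw [unitMonomial, inner_smul_left, unitMonomial, inner_smul_right, inner_monomial_monomial]
  split_ifs with hmn
  · subst hmn
    rw [Complex.conj_ofReal, ← Complex.ofReal_mul, ← Complex.ofReal_mul, ← Complex.ofReal_one,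
      Complex.ofReal_inj]
    have := Real.mul_self_sqrt (bergmanWeight_pos hα.out m).le
    field_simp
    linarith
  · simp

/-- The Hilbert basis of `A²_α` consisting of the normalized monomials. -/
def monomialBasis (α : ℝ) [hα : Fact (-1 < α)] : HilbertBasis ℕ ℂ (BergmanSpace α) :=
  HilbertBasis.mkOfOrthogonalEqBot (orthonormal_unitMonomial (α := α)) (by
    rw [eq_bot_iff]
    intro f hf
    rw [Submodule.mem_bot]
    refine ext_taylorCoeff (fun n => ?_)
    have h1 := (Submodule.mem_orthogonal _ f).1 hf (unitMonomial α n)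
      (Submodule.subset_span ⟨n, rfl⟩)
    have h := Real.sqrt_pos.2 (bergmanWeight_pos hα.out n)
    rw [inner_unitMonomial, mul_eq_zero, Complex.ofReal_eq_zero] at h1
    rw [h1.resolve_left h.ne', taylorCoeff_eq_of_hasSum (c := fun _ => 0)]
    simp)

theorem monomialBasis_apply [Fact (-1 < α)] (n : ℕ) : monomialBasis α n = unitMonomial α n := by
  simp [monomialBasis]

theorem monomialBasis_repr [Fact (-1 < α)] (f : BergmanSpace α) (n : ℕ) :
    (monomialBasis α).repr f n = √(bergmanWeight α n) * taylorCoeff f n := by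
  rw [HilbertBasis.repr_apply_apply, monomialBasis_apply, inner_unitMonomial]

theorem hasSum_norm_sq [hα : Fact (-1 < α)] (f : BergmanSpace α) :
    HasSum (fun n => bergmanWeight α n * ‖taylorCoeff f n‖ ^ 2) (‖f‖ ^ 2) := by
  have h := lp.hasSum_norm (p := 2) (by simp) ((monomialBasis α).repr f)
  rw [LinearIsometryEquiv.norm_map] at h
  simp only [ENNReal.toReal_ofNat, Real.rpow_two, monomialBasis_repr, norm_mul, mul_pow,
    Complex.norm_real, Real.norm_of_nonneg (Real.sqrt_nonneg _),
    Real.sq_sqrt (bergmanWeight_pos hα.out _).le] at h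
  exact h

/-- The Riesz–Fischer direction, through the Hilbert basis of normalized monomials. -/
theorem exists_taylorCoeff_eq [hα : Fact (-1 < α)] {c : ℕ → ℂ}
    (hc : Summable fun n => bergmanWeight α n * ‖c n‖ ^ 2) :
    ∃ f : BergmanSpace α, ∀ n, taylorCoeff f n = c n := by
  have hmem : Memℓp (fun n => (√(bergmanWeight α n) : ℂ) * c n) 2 := by
    rw [memℓp_gen_iff (by simp)]
    simp only [ENNReal.toReal_ofNat, Real.rpow_two, norm_mul, mul_pow,
      Complex.norm_real, Real.norm_of_nonneg (Real.sqrt_nonneg _),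
      Real.sq_sqrt (bergmanWeight_pos hα.out _).le]
    exact hc
  refine ⟨(monomialBasis α).repr.symm ⟨_, hmem⟩, fun n => ?_⟩
  have h := monomialBasis_repr ((monomialBasis α).repr.symm ⟨_, hmem⟩) n
  rw [LinearIsometryEquiv.apply_symm_apply] at h
  have h0 := Real.sqrt_pos.2 (bergmanWeight_pos hα.out n)
  exact (mul_left_cancel₀ (by simpa using h0.ne') h).symm

end BergmanSpace

/-! ### Power series criteria: membership, derivative and shift -/

theorem mem_bergman_iff_summable {γ : ℝ} (h : -1 < γ) {f : ℂ → ℂ}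
    (hf : DifferentiableOn ℂ f unitDisk) (hf0 : ∀ z, z ∉ unitDisk → f z = 0) :
    f ∈ bergman γ ↔ Summable fun n => bergmanWeight γ n * ‖taylorCoeff f n‖ ^ 2 := by
  have : Fact (-1 < γ) := ⟨h⟩
  refine ⟨fun hm => (BergmanSpace.hasSum_norm_sq (⟨f, hm⟩ : BergmanSpace γ)).summable,
    fun hs => ?_⟩
  obtain ⟨g, hg⟩ := BergmanSpace.exists_taylorCoeff_eq hs
  have : f = g := by
    ext z
    by_cases hz : z ∈ unitDisk
    · refine (hasSum_taylorCoeff hf hz).unique ?_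
      simp_rw [← hg]
      exact hasSum_taylorCoeff g.differentiableOn hz
    · rw [hf0 z hz, g.eq_zero_of_notMem hz]
  rw [this]
  exact g.2

theorem taylorCoeff_deriv (f : ℂ → ℂ) (n : ℕ) :
    taylorCoeff (deriv f) n = (n + 1) * taylorCoeff f (n + 1) := by
  have h : ((n : ℂ) + 1) ≠ 0 := by exact_mod_cast n.succ_ne_zero
  have h' : (n.factorial : ℂ) ≠ 0 := by exact_mod_cast n.factorial_ne_zero
  rw [taylorCoeff, taylorCoeff, iteratedDeriv_succ', Nat.factorial_succ]
  push_cast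
  field_simp

/-- Multiplying a convergent power series by the variable shifts its coefficients. -/
theorem HasSum.mul_var {c : ℕ → ℂ} {z s : ℂ} (h : HasSum (fun n => c n * z ^ n) s) :
    HasSum (fun n => (Nat.casesOn n 0 c : ℂ) * z ^ n) (z * s) := by
  have h1 := (hasSum_nat_add_iff (f := fun n => (Nat.casesOn n 0 c : ℂ) * z ^ n) (g := z * s) 1).1
  have h2 : z * s + ∑ i ∈ Finset.range 1, (Nat.casesOn i 0 c : ℂ) * z ^ i = z * s := by simp
  rw [h2] at h1
  refine h1 ?_
  have h3 : (fun n => (Nat.casesOn (n + 1) 0 c : ℂ) * z ^ (n + 1)) = fun n => z * (c n * z ^ n) := by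
    funext n
    simp only
    ring
  rw [h3]
  exact h.mul_left z

theorem hasSum_mul_deriv {f : ℂ → ℂ} (hf : DifferentiableOn ℂ f unitDisk) {z : ℂ}
    (hz : z ∈ unitDisk) : HasSum (fun n : ℕ => n * taylorCoeff f n * z ^ n) (z * deriv f z) := by
  have h := (hasSum_taylorCoeff (hf.deriv isOpen_unitDisk) hz).mul_var
  have h' : (fun n : ℕ => n * taylorCoeff f n * z ^ n) =
      fun n => (Nat.casesOn n 0 (taylorCoeff (deriv f)) : ℂ) * z ^ n := by
    funext n
    cases n with
    | zero => simp
    | succ n => simp [taylorCoeff_deriv]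
  rw [h']
  exact h

theorem memHInftyUnitBall_id : MemHInftyUnitBall (fun z => z) :=
  ⟨differentiableOn_id, fun _ hz => (mem_unitDisk.1 hz).le⟩

/-! ### The defect operator of the shift -/

namespace BergmanSpace

variable {α : ℝ}

theorem taylorCoeff_eq_inner [hα : Fact (-1 < α)] (f : BergmanSpace α) (n : ℕ) :
    taylorCoeff f n = (bergmanWeight α n : ℂ)⁻¹ * inner ℂ (monomial α n) f := by
  have h : (bergmanWeight α n : ℂ) ≠ 0 := by
    exact_mod_cast (bergmanWeight_pos hα.out n).ne'
  rw [inner_monomial, inv_mul_cancel_left₀ h]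

/-- The Taylor coefficient as a linear functional. -/
def taylorCoeffCLM (α : ℝ) [Fact (-1 < α)] (n : ℕ) : BergmanSpace α →L[ℂ] ℂ :=
  (bergmanWeight α n : ℂ)⁻¹ • innerSL ℂ (monomial α n)

theorem taylorCoeffCLM_apply [Fact (-1 < α)] (f : BergmanSpace α) (n : ℕ) :
    taylorCoeffCLM α n f = taylorCoeff f n := by
  rw [taylorCoeff_eq_inner]
  simp [taylorCoeffCLM]

theorem taylorCoeff_sub [Fact (-1 < α)] (f g : BergmanSpace α) (n : ℕ) :
    taylorCoeff (f - g : BergmanSpace α) n = taylorCoeff f n - taylorCoeff g n := by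
  simp only [← taylorCoeffCLM_apply, map_sub]

theorem shift_monomial [Fact (-1 < α)] (n : ℕ) :
    T α memHInftyUnitBall_id (monomial α n) = monomial α (n + 1) := by
  ext z
  rw [T_apply]
  by_cases hz : z ∈ unitDisk
  · rw [monomial_apply n hz, monomial_apply (n + 1) hz, pow_succ']
  · rw [eq_zero_of_notMem _ hz, eq_zero_of_notMem _ hz, mul_zero]

theorem taylorCoeff_shift [Fact (-1 < α)] (f : BergmanSpace α) (n : ℕ) :
    taylorCoeff (T α memHInftyUnitBall_id f) n = Nat.casesOn n 0 (taylorCoeff f) :=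
  taylorCoeff_eq_of_hasSum (c := fun n => Nat.casesOn n 0 (taylorCoeff f)) (fun z hz => by
    rw [T_apply]
    exact (hasSum_taylorCoeff f.differentiableOn hz).mul_var) n

/-- The defect operator `I - T_z T_z^*` of the shift. -/
def shiftDefect (α : ℝ) [Fact (-1 < α)] : BergmanSpace α →L[ℂ] BergmanSpace α :=
  E α memHInftyUnitBall_id

/-- T_z T_z^* is diagonal: it kills the constant term and multiplies coefficient n+1 by the ratio of
the weights at n+1 and n, which is (n+1)/(n+2+α). Subtracting from 1 leaves (1+α)/(n+2+α). -/
theorem taylorCoeff_shiftDefect [hα : Fact (-1 < α)] (f : BergmanSpace α) (n : ℕ) :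
    (n + 1 + α) * taylorCoeff (shiftDefect α f) n = (1 + α) * taylorCoeff f n := by
  rw [shiftDefect, E, _root_.sub_apply, taylorCoeff_sub,
    ContinuousLinearMap.comp_apply, taylorCoeff_shift, ContinuousLinearMap.id_apply]
  cases n with
  | zero => simp
  | succ n =>
    have h1 : (bergmanWeight α n : ℂ) ≠ 0 := by
      exact_mod_cast (bergmanWeight_pos hα.out n).ne'
    have h2 : ((n : ℂ) + 2 + α) * bergmanWeight α (n + 1) = (n + 1) * bergmanWeight α n := by
      exact_mod_cast bergmanWeight_succ hα.out n
    simp only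
    rw [taylorCoeff_eq_inner (ContinuousLinearMap.adjoint _ f), ContinuousLinearMap.adjoint_inner_right,
      shift_monomial, inner_monomial]
    push_cast
    field_simp
    linear_combination -taylorCoeff f (n + 1) * h2

theorem natCast_add_one_add_pos (α : ℝ) [hα : Fact (-1 < α)] (n : ℕ) : 0 < (n : ℝ) + 1 + α := by
  have := hα.out
  have : (0 : ℝ) ≤ n := n.cast_nonneg
  linarith

theorem natCast_add_one_add_ne_zero (α : ℝ) [Fact (-1 < α)] (n : ℕ) : (n : ℂ) + 1 + α ≠ 0 := by
  exact_mod_cast (natCast_add_one_add_pos α n).ne'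

/-- The inverse of the diagonal operator as a differential operator: z d/dz multiplies the n-th
coefficient by n. In this form the Leibniz rule can be applied. -/
theorem eq_shiftDefect_iff [hα : Fact (-1 < α)] {v h : BergmanSpace α} :
    v = shiftDefect α h ↔
      ∀ z ∈ unitDisk, z * deriv v z + (1 + α) * v z = (1 + α) * h z := by
  have key : ∀ v : BergmanSpace α, ∀ z ∈ unitDisk,
      HasSum (fun n : ℕ => (n + 1 + α) * taylorCoeff v n * z ^ n) (z * deriv v z + (1 + α) * v z) := by
    intro v z hz
    convert (hasSum_mul_deriv v.differentiableOn hz).add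
      ((hasSum_taylorCoeff v.differentiableOn hz).mul_left (1 + α : ℂ)) using 2
    ring
  constructor
  · rintro rfl z hz
    refine (key _ z hz).unique ?_
    simp_rw [taylorCoeff_shiftDefect, mul_assoc]
    exact (hasSum_taylorCoeff h.differentiableOn hz).mul_left _
  · intro H
    refine ext_taylorCoeff (fun n => ?_)
    refine mul_left_cancel₀ (natCast_add_one_add_ne_zero α n) ?_
    rw [taylorCoeff_shiftDefect]
    have h1 := taylorCoeff_eq_of_hasSum (key v) n
    rw [← h1, ← taylorCoeff_eq_of_hasSum (f := fun z => z * deriv v z + (1 + α) * v z)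
      (c := fun n => (1 + α) * taylorCoeff h n) (fun z hz => ?_)]
    rw [H z hz]
    simp_rw [mul_assoc]
    exact (hasSum_taylorCoeff h.differentiableOn hz).mul_left _

theorem shiftDefect_injective [hα : Fact (-1 < α)] : Function.Injective (shiftDefect α) := by
  intro f g hfg
  refine ext_taylorCoeff (fun n => ?_)
  have h : (1 + α : ℂ) ≠ 0 := by simpa using natCast_add_one_add_ne_zero α 0
  refine mul_left_cancel₀ h ?_
  rw [← taylorCoeff_shiftDefect, ← taylorCoeff_shiftDefect, hfg]

theorem isCompactOperator_shiftDefect [hα : Fact (-1 < α)] : IsCompactOperator (shiftDefect α) := by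
  have h1 : 0 < 1 + α := by linarith [hα.out]
  -- Finite rank truncations of the diagonal operator. The eigenvalues decrease to 0, so the error
  -- in norm is at most the first omitted one, (1+α)/(N+1+α).
  set F : ℕ → BergmanSpace α →L[ℂ] BergmanSpace α := fun N => ∑ n ∈ Finset.range N,
    ((1 + α) / (n + 1 + α) : ℂ) • (taylorCoeffCLM α n).smulRight (monomial α n) with hF
  have hcoeff : ∀ N f m, taylorCoeff (shiftDefect α f - F N f : BergmanSpace α) m =
      if m < N then 0 else (1 + α) / (m + 1 + α) * taylorCoeff f m := by
    intro N f m
    have h2 : taylorCoeff (shiftDefect α f) m = (1 + α) / (m + 1 + α) * taylorCoeff f m := by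
      rw [div_mul_eq_mul_div, eq_div_iff (natCast_add_one_add_ne_zero α m),
        ← taylorCoeff_shiftDefect, mul_comm]
    rw [taylorCoeff_sub, h2, ← taylorCoeffCLM_apply (F N f), hF]
    simp only [_root_.sum_apply, _root_.smul_apply,
      ContinuousLinearMap.smulRight_apply, map_sum, map_smul, taylorCoeffCLM_apply,
      taylorCoeff_monomial, smul_eq_mul, mul_ite, mul_one, mul_zero, Finset.sum_ite_eq,
      Finset.mem_range]
    split_ifs <;> simp
  refine isCompactOperator_of_tendsto (F := F) (l := atTop) ?_ (Eventually.of_forall fun N => ?_)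
  · rw [tendsto_iff_norm_sub_tendsto_zero]
    have hlim : Tendsto (fun N : ℕ => (1 + α) / (N + 1 + α)) atTop (𝓝 0) := by
      refine Tendsto.const_div_atTop ?_ _
      exact tendsto_atTop_add_const_right _ _
        (tendsto_atTop_add_const_right _ _ tendsto_natCast_atTop_atTop)
    refine squeeze_zero (fun _ => norm_nonneg _) (fun N => ?_) hlim
    have hN := natCast_add_one_add_pos α N
    rw [norm_sub_rev]
    refine ContinuousLinearMap.opNorm_le_bound _ (by positivity) (fun f => ?_)
    refine le_of_sq_le_sq ?_ (by positivity)
    rw [mul_pow, _root_.sub_apply]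
    refine hasSum_le (fun m => ?_) (hasSum_norm_sq (shiftDefect α f - F N f))
      ((hasSum_norm_sq f).mul_left _)
    have hw := bergmanWeight_pos hα.out m
    rw [hcoeff, mul_left_comm]
    refine mul_le_mul_of_nonneg_left ?_ hw.le
    split_ifs with hm
    · rw [norm_zero, zero_pow two_ne_zero]
      positivity
    · have hm' : (N : ℝ) ≤ m := by exact_mod_cast not_lt.1 hm
      have e : ‖((1 + α) / (m + 1 + α) : ℂ)‖ = (1 + α) / (m + 1 + α) := by
        have : ((1 + α) / (m + 1 + α) : ℂ) = (((1 + α) / (m + 1 + α) : ℝ) : ℂ) := by push_cast; rfl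
        rw [this, Complex.norm_real, Real.norm_of_nonneg]
        exact div_nonneg h1.le (natCast_add_one_add_pos α m).le
      rw [norm_mul, mul_pow, e]
      have := div_nonneg h1.le (natCast_add_one_add_pos α m).le
      gcongr
  · refine Submodule.sum_mem (compactOperator (RingHom.id ℂ) (BergmanSpace α) (BergmanSpace α))
      (fun n _ => Submodule.smul_mem _ _ ?_)
    exact (isCompactOperator_of_locallyCompactSpace_dom (taylorCoeffCLM α n)).clm_comp
      ((ContinuousLinearMap.id ℂ ℂ).smulRight (monomial α n))

end BergmanSpace

/-! ### The range of the shift defect is A²_{α-2} -/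

theorem summable_congr_of_bounds {u v : ℕ → ℝ} {a b : ℝ} (hu : ∀ n, 0 ≤ u n) (hv : ∀ n, 0 ≤ v n)
    (h1 : ∀ n, u n ≤ a * v n) (h2 : ∀ n, v n ≤ b * u n) : Summable u ↔ Summable v :=
  ⟨fun h => (h.mul_left b).of_nonneg_of_le hv h2, fun h => (h.mul_left a).of_nonneg_of_le hu h1⟩

theorem memLp_sub_two_iff {α : ℝ} (h : -1 < α) (h1 : α ≤ 1) {f : ℂ → ℂ} :
    MemLp (fun z => ((1 - ‖z‖ ^ 2 : ℝ) : ℂ) ^ 1 * iteratedDeriv 1 f z) 2 (weightedArea (α - 2)) ↔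
      MemLp (unitDisk.indicator (deriv f)) 2 (weightedArea α) := by
  have hm := measurable_deriv f
  have hm' : Measurable (unitDisk.indicator (deriv f)) := hm.indicator isOpen_unitDisk.measurableSet
  rw [iteratedDeriv_one, memLp_two_iff_integrable_sq_norm (by fun_prop),
    memLp_two_iff_integrable_sq_norm (by fun_prop), weightedArea, weightedArea,
    integrable_withDensity_iff_integrable_smul₀' (by fun_prop) (by simp),
    integrable_withDensity_iff_integrable_smul₀' (by fun_prop) (by simp)]
  -- The normalizing constants differ: α - 2 ≤ -1 gives the constant 1, while α gives α + 1.
  rw [← integrable_const_mul_iff (c := α + 1) (isUnit_iff_ne_zero.2 (by linarith))]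
  refine integrableOn_congr_fun (fun z hz => ?_) isOpen_unitDisk.measurableSet
  have hz1 : ‖z‖ < 1 := mem_unitDisk.1 hz
  have h2 : 0 < 1 - ‖z‖ ^ 2 := by nlinarith [norm_nonneg z]
  have h3 : (1 - ‖z‖ ^ 2) ^ α = (1 - ‖z‖ ^ 2) ^ (α - 2) * (1 - ‖z‖ ^ 2) ^ 2 := by
    rw [← Real.rpow_two (1 - ‖z‖ ^ 2), ← Real.rpow_add h2]
    simp
  have h4 := Real.pi_pos
  have h5 : 0 < α + 1 := by linarith
  rw [indicator_of_mem hz, weightConst, weightConst, if_neg (by linarith), if_pos h,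
    ENNReal.toReal_ofReal (by positivity), ENNReal.toReal_ofReal (by positivity), h3, pow_one,
    norm_mul, Complex.norm_real, Real.norm_of_nonneg h2.le]
  simp only [smul_eq_mul]
  ring

/-- Two regimes. For α ≤ 1 the definition uses one derivative, and membership means f' ∈ A²_α. For α
> 1 it uses none, and the weights of exponents α - 2 and α are compared directly. -/
theorem mem_bergman_sub_two_iff {α : ℝ} (h : -1 < α) {f : ℂ → ℂ}
    (hf : DifferentiableOn ℂ f unitDisk) (hf0 : ∀ z, z ∉ unitDisk → f z = 0) :
    f ∈ bergman (α - 2) ↔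
      Summable fun n : ℕ => (n + 1 + α) ^ 2 * (bergmanWeight α n * ‖taylorCoeff f n‖ ^ 2) := by
  have : Fact (-1 < α) := ⟨h⟩
  have hw := fun n => (bergmanWeight_pos h n).le
  by_cases h1 : α ≤ 1
  · have h2 : bergmanOrder (α - 2) = 1 := by
      rw [bergmanOrder, Nat.floor_eq_iff (by linarith)]
      constructor <;> norm_num <;> linarith
    have h3 : f ∈ bergman (α - 2) ↔ unitDisk.indicator (deriv f) ∈ bergman α := by
      rw [mem_bergman_iff_of_neg_one_lt h, ← memLp_sub_two_iff h h1, mem_bergman_iff]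
      constructor
      · intro hm
        have := hm.memLp
        rw [h2] at this
        exact ⟨(hf.deriv isOpen_unitDisk).congr (fun z hz => indicator_of_mem hz _),
          fun z hz => indicator_of_notMem hz _, this⟩
      · intro hm
        exact ⟨hf, hf0, by rw [h2]; exact hm.2.2⟩
    rw [h3, mem_bergman_iff_summable h
      ((hf.deriv isOpen_unitDisk).congr (fun z hz => indicator_of_mem hz _))
      (fun z hz => indicator_of_notMem hz _), ← summable_nat_add_iff 1 (G := ℝ)
      (f := fun n : ℕ => ((n : ℝ) + 1 + α) ^ 2 * (bergmanWeight α n * ‖taylorCoeff f n‖ ^ 2))]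
    have h4 : ∀ n, ‖taylorCoeff (unitDisk.indicator (deriv f)) n‖ ^ 2 =
        (n + 1) ^ 2 * ‖taylorCoeff f (n + 1)‖ ^ 2 := by
      intro n
      rw [taylorCoeff_congr (fun z hz => indicator_of_mem hz _), taylorCoeff_deriv, norm_mul,
        mul_pow]
      congr 2
      exact_mod_cast Complex.norm_natCast (n + 1)
    simp only [h4]
    -- After cancelling a common factor, the comparison is n+1 ≤ n+2+α ≤ 3(n+1), valid for -1 < α ≤
    -- 1.
    refine summable_congr_of_bounds (a := 1) (b := 3) (fun n => ?_) (fun n => ?_) (fun n => ?_)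
      (fun n => ?_)
    · have := hw n
      positivity
    · have := hw (n + 1)
      positivity
    all_goals
      have e := bergmanWeight_succ h n
      have e' : (((n + 1 : ℕ) : ℝ) + 1 + α) ^ 2 *
          (bergmanWeight α (n + 1) * ‖taylorCoeff f (n + 1)‖ ^ 2) =
          (n + 2 + α) * ((n + 1) * (bergmanWeight α n * ‖taylorCoeff f (n + 1)‖ ^ 2)) := by
        push_cast
        linear_combination (n + 2 + α) * ‖taylorCoeff f (n + 1)‖ ^ 2 * e
      have hn : (0 : ℝ) ≤ n := n.cast_nonneg
      have hX : 0 ≤ (n + 1) * (bergmanWeight α n * ‖taylorCoeff f (n + 1)‖ ^ 2) := by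
        have := hw n
        positivity
      rw [e']
      nlinarith
  · have h1' : 1 < α := not_le.1 h1
    rw [mem_bergman_iff_summable (show -1 < α - 2 by linarith) hf hf0]
    have e : ∀ n, α * (α + 1) * (bergmanWeight (α - 2) n * ‖taylorCoeff f n‖ ^ 2) =
        (n + α) * ((n + 1 + α) * (bergmanWeight α n * ‖taylorCoeff f n‖ ^ 2)) := fun n => by
      linear_combination -‖taylorCoeff f n‖ ^ 2 * bergmanWeight_sub_two h1' n
    have e0 : α * (α + 1) ≠ 0 := by positivity
    rw [← summable_mul_left_iff e0]
    simp only [e]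
    -- Here the comparison is n+α ≤ n+1+α ≤ 2(n+α), valid because α > 1.
    refine summable_congr_of_bounds (a := 1) (b := 2) (fun n => ?_) (fun n => ?_) (fun n => ?_)
      (fun n => ?_)
    all_goals
      have hn : (0 : ℝ) ≤ n := n.cast_nonneg
      have hX : 0 ≤ (n + 1 + α) * (bergmanWeight α n * ‖taylorCoeff f n‖ ^ 2) := by
        have := hw n
        positivity
    · positivity
    · rw [pow_two, mul_assoc]
      positivity
    · nlinarith
    · nlinarith

namespace BergmanSpace

variable {α : ℝ}

theorem range_shiftDefect [hα : Fact (-1 < α)] :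
    rangeE α memHInftyUnitBall_id = (bergman (α - 2) : Set (ℂ → ℂ)) := by
  have h0 : (0 : ℝ) < 1 + α := by linarith [hα.out]
  have hn : ∀ n : ℕ, ‖((n : ℂ) + 1 + α)‖ ^ 2 = (n + 1 + α) ^ 2 := fun n => by
    rw [show ((n : ℂ) + 1 + α) = ((n + 1 + α : ℝ) : ℂ) by push_cast; rfl, Complex.norm_real,
      Real.norm_eq_abs, sq_abs]
  have h0' : ‖(1 + α : ℂ)‖ ^ 2 = (1 + α) ^ 2 := by simpa using hn 0
  ext g
  constructor
  · rintro ⟨f, rfl⟩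
    refine (mem_bergman_sub_two_iff hα.out (differentiableOn _)
      (fun z hz => eq_zero_of_notMem _ hz)).2 ?_
    refine ((hasSum_norm_sq f).summable.mul_left ((1 + α) ^ 2)).congr (fun n => ?_)
    have := congrArg (fun w => ‖w‖ ^ 2) (taylorCoeff_shiftDefect f n)
    simp only [norm_mul, mul_pow, hn, h0'] at this
    rw [mul_left_comm, ← this, mul_left_comm]
    rfl
  · intro hg
    have hd : DifferentiableOn ℂ g unitDisk := hg.1
    have hz : ∀ z, z ∉ unitDisk → g z = 0 := hg.2
    have hs := (mem_bergman_sub_two_iff hα.out hd hz).1 hg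
    obtain ⟨f, hf⟩ := exists_taylorCoeff_eq (α := α)
      (c := fun n => (n + 1 + α) / (1 + α) * taylorCoeff g n) (by
        refine (hs.mul_left ((1 + α) ^ 2)⁻¹).congr (fun n => ?_)
        rw [norm_mul, norm_div, mul_pow, div_pow, hn, h0']
        field_simp)
    refine ⟨f, ?_⟩
    funext z
    by_cases hzd : z ∈ unitDisk
    · refine (hasSum_taylorCoeff (differentiableOn _) hzd).unique ?_
      have e : ∀ n, taylorCoeff (shiftDefect α f) n = taylorCoeff g n := by
        intro n
        refine mul_left_cancel₀ (natCast_add_one_add_ne_zero α n) ?_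
        have h0'' : (1 + α : ℂ) ≠ 0 := by exact_mod_cast h0.ne'
        rw [taylorCoeff_shiftDefect, hf]
        field_simp
      have e' : ∀ n, taylorCoeff (E α memHInftyUnitBall_id f) n = taylorCoeff g n := e
      simp_rw [e']
      exact hasSum_taylorCoeff hd hzd
    · rw [hz z hzd]
      exact eq_zero_of_notMem _ hzd

end BergmanSpace

/-! ### Bounded multipliers and their commutation with the shift defect -/

/-- Bounded holomorphic functions on the unit disk. -/
structure MemHInfty (g : ℂ → ℂ) : Prop where
  differentiableOn : DifferentiableOn ℂ g unitDisk
  bounded : ∃ C : ℝ, ∀ z ∈ unitDisk, ‖g z‖ ≤ C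

theorem MemHInfty.mul {g h : ℂ → ℂ} (hg : MemHInfty g) (hh : MemHInfty h) :
    MemHInfty (fun z => g z * h z) := by
  obtain ⟨C, hC⟩ := hg.bounded
  obtain ⟨D, hD⟩ := hh.bounded
  refine ⟨hg.1.mul hh.1, C * D, fun z hz => ?_⟩
  rw [norm_mul]
  exact mul_le_mul (hC z hz) (hD z hz) (norm_nonneg _) ((norm_nonneg _).trans (hC z hz))

theorem MemHInftyUnitBall.memHInfty {g : ℂ → ℂ} (hg : MemHInftyUnitBall g) : MemHInfty g :=
  ⟨hg.1, 1, hg.2⟩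

/-- The operator `T` only accepts symbols bounded by 1, so a general multiplier is obtained as a
scalar multiple of a rescaled one. -/
theorem MemHInfty.exists_scale {g : ℂ → ℂ} (hg : MemHInfty g) :
    ∃ C : ℝ, C ≠ 0 ∧ MemHInftyUnitBall (fun z => (C : ℂ)⁻¹ * g z) := by
  obtain ⟨C, hC⟩ := hg.bounded
  have h0 : 0 < |C| + 1 := by positivity
  refine ⟨|C| + 1, h0.ne', hg.1.const_mul _, fun z hz => ?_⟩
  rw [norm_mul, norm_inv, Complex.norm_real, Real.norm_of_nonneg h0.le, inv_mul_le_one₀ h0]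
  linarith [hC z hz, le_abs_self C]

namespace BergmanSpace

variable {α : ℝ}

open Classical in
/-- Multiplication by a bounded holomorphic function on `A²_α` (zero for other functions). -/
def multiplier (α : ℝ) [Fact (-1 < α)] (g : ℂ → ℂ) : BergmanSpace α →L[ℂ] BergmanSpace α :=
  if h : ∃ C : ℝ, C ≠ 0 ∧ MemHInftyUnitBall (fun z => (C : ℂ)⁻¹ * g z) then
    (h.choose : ℂ) • T α h.choose_spec.2 else 0

theorem multiplier_apply [Fact (-1 < α)] {g : ℂ → ℂ} (hg : MemHInfty g) (f : BergmanSpace α)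
    (z : ℂ) : multiplier α g f z = g z * f z := by
  have h := hg.exists_scale
  have h0 : (h.choose : ℂ) ≠ 0 := by exact_mod_cast h.choose_spec.1
  rw [multiplier, dif_pos h, _root_.smul_apply, smul_apply, T_apply,
    ← mul_assoc, mul_inv_cancel_left₀ h0]

theorem T_eq_multiplier [Fact (-1 < α)] {φ : ℂ → ℂ} (hφ : MemHInftyUnitBall φ) :
    T α hφ = multiplier α φ := by
  ext f z
  rw [T_apply, multiplier_apply hφ.memHInfty]

theorem multiplier_eq_mul [Fact (-1 < α)] {g h k : ℂ → ℂ} (hg : MemHInfty g) (hh : MemHInfty h)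
    (hk : MemHInfty k) (e : ∀ z ∈ unitDisk, k z = g z * h z) :
    multiplier α k = multiplier α g * multiplier α h := by
  ext f z
  change multiplier α k f z = multiplier α g (multiplier α h f) z
  rw [multiplier_apply hk, multiplier_apply hg, multiplier_apply hh, ← mul_assoc]
  by_cases hz : z ∈ unitDisk
  · rw [e z hz]
  · rw [eq_zero_of_notMem _ hz, mul_zero, mul_zero]

theorem E_eq [Fact (-1 < α)] {φ : ℂ → ℂ} (hφ : MemHInftyUnitBall φ) :
    E α hφ = 1 - multiplier α φ * star (multiplier α φ) := by
  rw [E, T_eq_multiplier]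
  rfl

theorem shiftDefect_eq [Fact (-1 < α)] :
    shiftDefect α = 1 - multiplier α (fun z => z) * star (multiplier α fun z => z) :=
  E_eq _

/-- Apply 1 + (1+α)⁻¹ z d/dz, the inverse of P, to g · Pf. The Leibniz rule gives g f plus (1+α)⁻¹ z
g' Pf, and the second term is compact in f because P is. -/
theorem multiplier_comp_shiftDefect [hα : Fact (-1 < α)] {g : ℂ → ℂ} (hg : MemHInfty g)
    (hg' : MemHInfty (deriv g)) :
    ∃ K : BergmanSpace α →L[ℂ] BergmanSpace α, IsCompactOperator K ∧
      multiplier α g * shiftDefect α = shiftDefect α * (multiplier α g + K) := by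
  have h0 : (1 + α : ℂ) ≠ 0 := by simpa using natCast_add_one_add_ne_zero α 0
  have hz := memHInftyUnitBall_id.memHInfty
  refine ⟨(1 + α : ℂ)⁻¹ • (multiplier α (fun z => z * deriv g z) * shiftDefect α), ?_, ?_⟩
  · exact (isCompactOperator_shiftDefect.clm_comp (multiplier α fun z => z * deriv g z)).smul (1 + α : ℂ)⁻¹
  · ext1 f
    refine eq_shiftDefect_iff.2 (fun z hzd => ?_)
    have h1 := eq_shiftDefect_iff.1 (rfl : shiftDefect α f = shiftDefect α f) z hzd
    have e : (multiplier α g (shiftDefect α f) : ℂ → ℂ) =ᶠ[𝓝 z]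
        fun w => g w * shiftDefect α f w := Eventually.of_forall (multiplier_apply hg _)
    have hd := isOpen_unitDisk.mem_nhds hzd
    have e2 := (hg.1.differentiableAt hd).hasDerivAt.mul
      ((differentiableOn (shiftDefect α f)).differentiableAt hd).hasDerivAt
    have e3 : deriv (multiplier α g (shiftDefect α f)) z = _ := e.deriv_eq.trans e2.deriv
    change z * deriv (multiplier α g (shiftDefect α f)) z +
      (1 + α) * multiplier α g (shiftDefect α f) z = (1 + α) * (multiplier α g f z +
        (1 + α : ℂ)⁻¹ * multiplier α (fun z => z * deriv g z) (shiftDefect α f) z)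
    rw [e3, multiplier_apply hg, multiplier_apply hg, multiplier_apply (hz.mul hg')]
    field_simp
    linear_combination g z * h1

end BergmanSpace

/-! ### Blaschke factors -/

/-- The Blaschke factor with zero `a`. -/
def blaschkeFactor (a z : ℂ) : ℂ := (z - a) / (1 - conj a * z)

theorem one_sub_conj_mul_ne_zero {a z : ℂ} (ha : a ∈ unitDisk) (hz : z ∈ unitDisk) :
    1 - conj a * z ≠ 0 := by
  rw [mem_unitDisk] at ha hz
  intro h
  have h1 : ‖conj a * z‖ = 1 := by rw [← sub_eq_zero.1 h, norm_one]
  rw [norm_mul, Complex.norm_conj] at h1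
  nlinarith [norm_nonneg a, norm_nonneg z]

theorem one_sub_norm_le {a z : ℂ} (hz : z ∈ unitDisk) :
    1 - ‖a‖ ≤ ‖1 - conj a * z‖ := by
  rw [mem_unitDisk] at hz
  have h := norm_sub_norm_le 1 (conj a * z)
  rw [norm_mul, Complex.norm_conj, norm_one] at h
  nlinarith [norm_nonneg a, norm_nonneg z]

theorem normSq_one_sub_conj_mul (a z : ℂ) :
    ‖1 - conj a * z‖ ^ 2 = ‖z - a‖ ^ 2 + (1 - ‖a‖ ^ 2) * (1 - ‖z‖ ^ 2) := by
  simp only [← Complex.normSq_eq_norm_sq, Complex.normSq_apply]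
  simp
  ring

theorem norm_blaschkeFactor_sq {a z : ℂ} (ha : a ∈ unitDisk) (hz : z ∈ unitDisk) :
    ‖blaschkeFactor a z‖ ^ 2 = 1 - (1 - ‖a‖ ^ 2) * (1 - ‖z‖ ^ 2) / ‖1 - conj a * z‖ ^ 2 := by
  have h : ‖1 - conj a * z‖ ^ 2 ≠ 0 :=
    pow_ne_zero 2 (norm_ne_zero_iff.2 (one_sub_conj_mul_ne_zero ha hz))
  rw [blaschkeFactor, norm_div, div_pow, eq_sub_iff_add_eq, ← add_div, div_eq_one_iff_eq h,
    normSq_one_sub_conj_mul]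

theorem differentiableOn_inv_one_sub {a : ℂ} (ha : a ∈ unitDisk) :
    DifferentiableOn ℂ (fun z => (1 - conj a * z)⁻¹) unitDisk := by
  refine DifferentiableOn.inv (by fun_prop) (fun z hz => one_sub_conj_mul_ne_zero ha hz)

theorem memHInfty_inv_one_sub {a : ℂ} (ha : a ∈ unitDisk) :
    MemHInfty (fun z => (1 - conj a * z)⁻¹) := by
  refine ⟨differentiableOn_inv_one_sub ha, (1 - ‖a‖)⁻¹, fun z hz => ?_⟩
  have h := mem_unitDisk.1 ha
  rw [norm_inv]
  exact inv_anti₀ (by linarith) (one_sub_norm_le hz)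

theorem memHInfty_const (c : ℂ) : MemHInfty fun _ => c :=
  ⟨differentiableOn_const c, ‖c‖, fun _ _ => le_rfl⟩

theorem MemHInfty.sub {g h : ℂ → ℂ} (hg : MemHInfty g) (hh : MemHInfty h) :
    MemHInfty (fun z => g z - h z) := by
  obtain ⟨C, hC⟩ := hg.bounded
  obtain ⟨D, hD⟩ := hh.bounded
  exact ⟨hg.1.sub hh.1, C + D, fun z hz => (norm_sub_le _ _).trans (add_le_add (hC z hz) (hD z hz))⟩

theorem MemHInfty.congr {g h : ℂ → ℂ} (hg : MemHInfty g) (e : EqOn h g unitDisk) :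
    MemHInfty h := by
  obtain ⟨C, hC⟩ := hg.bounded
  exact ⟨hg.1.congr e, C, fun z hz => by rw [e hz]; exact hC z hz⟩

theorem memHInfty_deriv_inv_one_sub {a : ℂ} (ha : a ∈ unitDisk) :
    MemHInfty (deriv fun z => (1 - conj a * z)⁻¹) := by
  have h := memHInfty_inv_one_sub ha
  refine (((memHInfty_const (conj a)).mul h).mul h).congr (fun z hz => ?_)
  have hne := one_sub_conj_mul_ne_zero ha hz
  have hd : HasDerivAt (fun z => 1 - conj a * z) (-(conj a * 1)) z :=
    ((hasDerivAt_id z).const_mul (conj a)).const_sub 1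
  rw [(hd.fun_inv hne).deriv]
  field_simp

theorem memHInftyUnitBall_blaschkeFactor {a : ℂ} (ha : a ∈ unitDisk) :
    MemHInftyUnitBall (blaschkeFactor a) := by
  refine ⟨DifferentiableOn.div (by fun_prop) (by fun_prop)
    (fun z hz => one_sub_conj_mul_ne_zero ha hz), fun z hz => ?_⟩
  refine le_of_sq_le_sq ?_ zero_le_one
  rw [norm_blaschkeFactor_sq ha hz]
  rw [mem_unitDisk] at ha hz
  have h1 : 0 ≤ 1 - ‖a‖ ^ 2 := by nlinarith [norm_nonneg a]
  have h2 : 0 ≤ 1 - ‖z‖ ^ 2 := by nlinarith [norm_nonneg z]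
  have : 0 ≤ (1 - ‖a‖ ^ 2) * (1 - ‖z‖ ^ 2) / ‖1 - conj a * z‖ ^ 2 := by positivity
  linarith

theorem memHInfty_deriv_blaschkeFactor {a : ℂ} (ha : a ∈ unitDisk) :
    MemHInfty (deriv (blaschkeFactor a)) := by
  have h := memHInfty_inv_one_sub ha
  refine (((memHInfty_const (1 - conj a * a)).mul h).mul h).congr (fun z hz => ?_)
  have hne := one_sub_conj_mul_ne_zero ha hz
  have hd : HasDerivAt (fun z => 1 - conj a * z) (-(conj a * 1)) z :=
    ((hasDerivAt_id z).const_mul (conj a)).const_sub 1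
  have hd2 := ((hasDerivAt_id z).sub_const a).fun_div hd hne
  have e : deriv (blaschkeFactor a) z = _ := hd2.deriv
  rw [e]
  simp only [id]
  field_simp
  ring

/-! ### Algebra of defect operators -/

namespace BergmanSpace

variable {α : ℝ}

/-- The operator version of `normSq_one_sub_conj_mul`. The factors are kept in the order Z, Z^*, so
the cross terms cancel although Z and Z^* need not commute. -/
theorem one_sub_mul_star_of_mobius {R : Type*} [Ring R] [StarRing R] [Algebra ℂ R] [StarModule ℂ R]
    {e Z B : R} {a : ℂ} (h1 : e * (1 - conj a • Z) = 1) (h2 : B = e * (Z - a • 1)) :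
    1 - B * star B = ((1 - ‖a‖ ^ 2 : ℝ) : ℂ) • (e * (1 - Z * star Z) * star e) := by
  have h3 : (1 : R) = (e * (1 - conj a • Z)) * star (e * (1 - conj a • Z)) := by
    rw [h1, star_one, one_mul]
  have h4 : (1 - conj a • Z) * star (1 - conj a • Z) - (Z - a • 1) * star (Z - a • 1) =
      ((1 - ‖a‖ ^ 2 : ℝ) : ℂ) • (1 - Z * star Z) := by
    have : ((1 - ‖a‖ ^ 2 : ℝ) : ℂ) = 1 - a * conj a := by
      rw [Complex.mul_conj']; push_cast; rfl
    rw [this]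
    simp only [star_sub, star_smul, star_one, mul_sub, sub_mul, one_mul, mul_one,
      smul_mul_assoc, mul_smul_comm, smul_smul, sub_smul, smul_sub, RCLike.star_def,
      Complex.conj_conj, one_smul]
    rw [mul_comm (conj a) a]
    abel
  calc 1 - B * star B = e * ((1 - conj a • Z) * star (1 - conj a • Z) -
        (Z - a • 1) * star (Z - a • 1)) * star e := by
        rw [h2]
        nth_rewrite 1 [h3]
        rw [star_mul, star_mul]
        noncomm_ring
    _ = _ := by
        rw [h4]
        simp only [smul_mul_assoc, mul_smul_comm]

theorem multiplier_one_sub [Fact (-1 < α)] (a : ℂ) :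
    multiplier α (fun z => 1 - conj a * z) = 1 - conj a • multiplier α (fun z => z) := by
  have hz := memHInftyUnitBall_id.memHInfty
  ext f z
  rw [multiplier_apply ((memHInfty_const 1).sub ((memHInfty_const _).mul hz))]
  change _ = f z - conj a * multiplier α (fun z => z) f z
  rw [multiplier_apply hz]
  ring

theorem multiplier_sub_const [Fact (-1 < α)] (a : ℂ) :
    multiplier α (fun z => z - a) = multiplier α (fun z => z) - a • 1 := by
  have hz := memHInftyUnitBall_id.memHInfty
  ext f z
  rw [multiplier_apply (hz.sub (memHInfty_const a))]
  change _ = multiplier α (fun z => z) f z - a * f z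
  rw [multiplier_apply hz]
  ring

theorem multiplier_one [Fact (-1 < α)] : multiplier α (fun _ => 1) = 1 := by
  ext f z
  rw [multiplier_apply (memHInfty_const 1), one_mul]
  rfl

theorem defect_blaschkeFactor [Fact (-1 < α)] {a : ℂ} (ha : a ∈ unitDisk) :
    E α (memHInftyUnitBall_blaschkeFactor ha) = ((1 - ‖a‖ ^ 2 : ℝ) : ℂ) •
      (multiplier α (fun z => (1 - conj a * z)⁻¹) * shiftDefect α *
        star (multiplier α fun z => (1 - conj a * z)⁻¹)) := by
  have hz := memHInftyUnitBall_id.memHInfty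
  have he := memHInfty_inv_one_sub ha
  have hq : MemHInfty (fun z => 1 - conj a * z) :=
    (memHInfty_const 1).sub ((memHInfty_const _).mul hz)
  have hb := (memHInftyUnitBall_blaschkeFactor ha).memHInfty
  set e := multiplier α (fun z => (1 - conj a * z)⁻¹)
  set Z := multiplier α (fun z => z)
  set B := multiplier α (blaschkeFactor a)
  have h1 : e * (1 - conj a • Z) = 1 := by
    rw [← multiplier_one_sub, ← multiplier_eq_mul he hq (memHInfty_const 1), multiplier_one]
    intro z hzd
    rw [inv_mul_cancel₀ (one_sub_conj_mul_ne_zero ha hzd)]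
  have h2 : B = e * (Z - a • 1) := by
    rw [← multiplier_sub_const, ← multiplier_eq_mul he (hz.sub (memHInfty_const a)) hb]
    intro z hzd
    rw [blaschkeFactor, div_eq_inv_mul]
  rw [E_eq, shiftDefect_eq]
  exact one_sub_mul_star_of_mobius h1 h2

end BergmanSpace

/-- The strong maximum principle: the value 1 of |φ| at an interior point would make φ constant. -/
theorem MemHInftyUnitBall.norm_lt_one {φ : ℂ → ℂ} (hφ : MemHInftyUnitBall φ)
    (hconst : ¬ ∃ c : ℂ, ‖c‖ = 1 ∧ ∀ z ∈ unitDisk, φ z = c) {z : ℂ} (hz : z ∈ unitDisk) :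
    ‖φ z‖ < 1 := by
  refine lt_of_le_of_ne (hφ.norm_le_one z hz) (fun h => hconst ⟨φ z, h, ?_⟩)
  refine Complex.eqOn_of_isPreconnected_of_isMaxOn_norm (convex_ball (0 : ℂ) 1).isPreconnected
    isOpen_unitDisk hφ.differentiableOn hz (fun w hw => ?_)
  simpa [h] using hφ.norm_le_one w hw

theorem one_sub_mul_mul_star {R : Type*} [Ring R] [StarRing R] (B C : R) :
    1 - (B * C) * star (B * C) = (1 - B * star B) + B * (1 - C * star C) * star B := by
  rw [star_mul]
  noncomm_ring

/-- In the application e' and B' are the adjoints of e and B. Only the left factors move past P; the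
main part keeps its symmetric shape, and every other term contains one of K, K₁, K₂. -/
theorem conj_add_conj_eq {R : Type*} [Ring R] [Algebra ℂ R] {P e e' B B' A K K₁ K₂ : R}
    (s : ℂ) (he : e * P = P * (e + K₁)) (hB : B * P = P * (B + K₂)) :
    s • (e * P * e') + B * (P * (A + K)) * B' =
      P * ((s • (e * e') + B * A * B') + (s • (K₁ * e') + B * K * B' + K₂ * (A + K) * B')) := by
  rw [← mul_assoc B, hB, he]
  simp only [mul_add, add_mul, mul_smul_comm, smul_add, mul_assoc]
  abel

/-- A coercive operator plus a compact one is surjective as soon as it is injective. -/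
theorem surjective_add_of_injective {H : Type*} [NormedAddCommGroup H] [InnerProductSpace ℂ H]
    [CompleteSpace H] {A K : H →L[ℂ] H} {c : ℝ} (hc : 0 < c)
    (hA : ∀ f, c * ‖f‖ ^ 2 ≤ (inner ℂ (A f) f : ℂ).re) (hK : IsCompactOperator K)
    (hinj : Function.Injective (A + K)) : Function.Surjective (A + K) := by
  -- Lax–Milgram: coercivity makes A invertible, so that A + K = A (1 + A⁻¹K).
  have hu : IsUnit A := by
    refine ContinuousLinearMap.isUnit_of_forall_le_norm_inner_map A (c := ⟨c, hc.le⟩) hc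
      (fun f => ?_)
    change ‖f‖ ^ 2 * c ≤ _
    rw [mul_comm]
    exact (hA f).trans (Complex.re_le_norm _)
  obtain ⟨U, rfl⟩ := hu
  set S : H →L[ℂ] H := (↑U⁻¹ : H →L[ℂ] H) * K with hS
  have hSc : IsCompactOperator S := hK.clm_comp (↑U⁻¹ : H →L[ℂ] H)
  have hfac : (U : H →L[ℂ] H) + K = U * (1 + S) := by
    rw [hS, mul_add, mul_one, ← mul_assoc, Units.mul_inv, one_mul]
  -- Fredholm alternative at the nonzero value -1: an eigenvector of A⁻¹K for -1 would lie in the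
  -- kernel of A + K.
  have hres : (-1 : ℂ) ∈ resolventSet ℂ S := by
    refine (hSc.hasEigenvalue_or_mem_resolventSet (by norm_num)).resolve_left (fun hev => ?_)
    obtain ⟨v, hv⟩ := hev.exists_hasEigenvector
    refine hv.2 (hinj ?_)
    have h1 : S v = (-1 : ℂ) • v := hv.apply_eq_smul
    rw [hfac, map_zero]
    change (U : H →L[ℂ] H) (v + S v) = 0
    rw [h1]
    simp
  have hun : IsUnit (1 + S) := by
    have := hres.neg
    rwa [map_neg, map_one, neg_sub, sub_neg_eq_add, add_comm] at this
  rw [hfac]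
  exact ((ContinuousLinearMap.isUnit_iff_bijective.1 (U.isUnit.mul hun))).2

/-! ### From finite Blaschke products to the range -/

namespace BergmanSpace

variable {α : ℝ}

/-- If E_φ f = 0, then f = φ g with g = T_φ^* f, and the adjoint relation gives ‖g‖ = ‖φ g‖. As |φ|
< 1 throughout the disk, g vanishes, hence f does too. -/
theorem E_injective [hα : Fact (-1 < α)] {φ : ℂ → ℂ} (hφ : MemHInftyUnitBall φ)
    (hconst : ¬ ∃ c : ℂ, ‖c‖ = 1 ∧ ∀ z ∈ unitDisk, φ z = c) :
    Function.Injective (E α hφ) := by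
  refine (injective_iff_map_eq_zero _).2 (fun f hf => ?_)
  set g := ContinuousLinearMap.adjoint (T α hφ) f with hg
  have h1 : f = T α hφ g := by
    have : f - T α hφ g = 0 := hf
    exact sub_eq_zero.1 this
  have h2 : ‖g‖ ^ 2 = ‖T α hφ g‖ ^ 2 := by
    have h3 : inner ℂ g g = inner ℂ (T α hφ g) f :=
      ContinuousLinearMap.adjoint_inner_right (T α hφ) g f
    rw [← h1, ← Complex.ofReal_inj]
    have e1 := inner_self_eq_norm_sq_to_K (𝕜 := ℂ) g
    have e2 := inner_self_eq_norm_sq_to_K (𝕜 := ℂ) f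
    rw [h3, ← h1, e2] at e1
    push_cast
    exact e1.symm
  have hg0 : g = 0 := by
    apply g.eq_zero_of_ae
    rw [norm_sq_eq, norm_sq_eq, ← sub_eq_zero] at h2
    have i1 := g.memLp.integrable_norm_pow (p := 2) (by simp)
    have i2 := (T α hφ g).memLp.integrable_norm_pow (p := 2) (by simp)
    have i3 : Integrable (fun x => ‖g x‖ ^ 2 - ‖T α hφ g x‖ ^ 2) (weightedArea α) := i1.sub i2
    rw [← integral_sub i1 i2, integral_eq_zero_iff_of_nonneg_ae ?_ i3] at h2
    · filter_upwards [h2, ae_mem_unitDisk α] with z hz hzd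
      have hlt := hφ.norm_lt_one hconst hzd
      simp only [T_apply, norm_mul, Pi.zero_apply] at hz
      have : (1 - ‖φ z‖ ^ 2) * ‖g z‖ ^ 2 = 0 := by linarith
      have h4 : 1 - ‖φ z‖ ^ 2 ≠ 0 := by nlinarith [norm_nonneg (φ z)]
      simpa [h4] using this
    · filter_upwards [ae_mem_unitDisk α] with z hzd
      have hle := hφ.norm_le_one z hzd
      simp only [T_apply, norm_mul, Pi.zero_apply, mul_pow]
      have : ‖φ z‖ ^ 2 ≤ 1 := pow_le_one₀ (norm_nonneg _) hle
      nlinarith [sq_nonneg ‖g z‖]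
  rw [h1, hg0, map_zero]

theorem E_mul [Fact (-1 < α)] {b ψ φ : ℂ → ℂ} (hb : MemHInftyUnitBall b)
    (hψ : MemHInftyUnitBall ψ) (hφ : MemHInftyUnitBall φ)
    (e : ∀ z ∈ unitDisk, φ z = b z * ψ z) :
    E α hφ = E α hb + multiplier α b * E α hψ * star (multiplier α b) := by
  rw [E_eq, E_eq, E_eq, multiplier_eq_mul hb.memHInfty hψ.memHInfty hφ.memHInfty e]
  exact one_sub_mul_mul_star _ _

/-- Multiplying `ψ` by a Blaschke factor makes the positive part of the defect coercive. -/
theorem E_blaschkeFactor_mul [hα : Fact (-1 < α)] {a : ℂ} (ha : a ∈ unitDisk) {ψ φ : ℂ → ℂ}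
    (hψ : MemHInftyUnitBall ψ) (hφ : MemHInftyUnitBall φ)
    (e : ∀ z ∈ unitDisk, φ z = blaschkeFactor a z * ψ z)
    {A K : BergmanSpace α →L[ℂ] BergmanSpace α} (hA : ∀ f, 0 ≤ (inner ℂ (A f) f : ℂ).re)
    (hK : IsCompactOperator K) (hE : E α hψ = shiftDefect α * (A + K)) :
    ∃ A' K' : BergmanSpace α →L[ℂ] BergmanSpace α, ∃ c > 0,
      (∀ f, c * ‖f‖ ^ 2 ≤ (inner ℂ (A' f) f : ℂ).re) ∧ IsCompactOperator K' ∧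
      E α hφ = shiftDefect α * (A' + K') := by
  have hz := memHInftyUnitBall_id.memHInfty
  have he := memHInfty_inv_one_sub ha
  have hq : MemHInfty (fun z => 1 - conj a * z) :=
    (memHInfty_const 1).sub ((memHInfty_const _).mul hz)
  have hb := memHInftyUnitBall_blaschkeFactor ha
  obtain ⟨K₁, hK₁, h1⟩ := multiplier_comp_shiftDefect (α := α) he (memHInfty_deriv_inv_one_sub ha)
  obtain ⟨K₂, hK₂, h2⟩ := multiplier_comp_shiftDefect (α := α) hb.memHInfty
    (memHInfty_deriv_blaschkeFactor ha)
  have hs : 0 < 1 - ‖a‖ ^ 2 := by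
    have := mem_unitDisk.1 ha
    nlinarith [norm_nonneg a]
  set M := multiplier α (fun z => (1 - conj a * z)⁻¹) with hM
  set B := multiplier α (blaschkeFactor a) with hB
  set Q := multiplier α (fun z => 1 - conj a * z) with hQ
  -- A bounded left inverse of M^* bounds M^* from below; this is the source of coercivity. The +1
  -- in the next estimate keeps the constant positive without knowing that ‖Q^*‖ ≠ 0.
  have hMQ : star Q * star M = 1 := by
    rw [← star_mul, hM, hQ, ← multiplier_eq_mul he hq (memHInfty_const 1), multiplier_one, star_one]
    intro z hzd
    rw [inv_mul_cancel₀ (one_sub_conj_mul_ne_zero ha hzd)]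
  have hlow : ∀ f, ‖f‖ ≤ (‖star Q‖ + 1) * ‖star M f‖ := by
    intro f
    have h3 : star Q (star M f) = f := by
      change (star Q * star M) f = f
      rw [hMQ]
      rfl
    calc ‖f‖ = ‖star Q (star M f)‖ := by rw [h3]
      _ ≤ ‖star Q‖ * ‖star M f‖ := ContinuousLinearMap.le_opNorm _ _
      _ ≤ _ := by
        gcongr
        linarith
  -- The term (1-|a|²) M M^* is coercive and B A B^* has nonnegative real part, so A itself need not
  -- be coercive.
  refine ⟨((1 - ‖a‖ ^ 2 : ℝ) : ℂ) • (M * star M) + B * A * star B,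
    ((1 - ‖a‖ ^ 2 : ℝ) : ℂ) • (K₁ * star M) + B * K * star B + K₂ * (A + K) * star B,
    (1 - ‖a‖ ^ 2) / (‖star Q‖ + 1) ^ 2, by positivity, fun f => ?_, ?_, ?_⟩
  · have e1 : inner ℂ (((((1 - ‖a‖ ^ 2 : ℝ) : ℂ) • (M * star M) + B * A * star B :
        BergmanSpace α →L[ℂ] BergmanSpace α)) f) f =
        ((1 - ‖a‖ ^ 2 : ℝ) : ℂ) * inner ℂ (star M f) (star M f) +
          inner ℂ (A (star B f)) (star B f) := by
      change inner ℂ (((1 - ‖a‖ ^ 2 : ℝ) : ℂ) • M (star M f) + B (A (star B f))) f = _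
      rw [inner_add_left, inner_smul_left, Complex.conj_ofReal,
        ContinuousLinearMap.star_eq_adjoint, ContinuousLinearMap.star_eq_adjoint,
        ContinuousLinearMap.adjoint_inner_right, ContinuousLinearMap.adjoint_inner_right]
    rw [e1, Complex.add_re, Complex.re_ofReal_mul]
    have e2 : (inner ℂ (star M f) (star M f) : ℂ).re = ‖star M f‖ ^ 2 :=
      (norm_sq_eq_re_inner (𝕜 := ℂ) (star M f)).symm
    have h4 := hA (star B f)
    have h5 : ‖f‖ ^ 2 ≤ (‖star Q‖ + 1) ^ 2 * ‖star M f‖ ^ 2 := by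
      rw [← mul_pow]
      exact pow_le_pow_left₀ (norm_nonneg _) (hlow f) 2
    rw [e2, div_mul_eq_mul_div]
    have h6 : (1 - ‖a‖ ^ 2) * ‖f‖ ^ 2 / (‖star Q‖ + 1) ^ 2 ≤ (1 - ‖a‖ ^ 2) * ‖star M f‖ ^ 2 := by
      rw [div_le_iff₀ (by positivity)]
      nlinarith
    linarith
  · have c1 : IsCompactOperator (K₁ * star M) := hK₁.comp_clm (star M)
    have c2 : IsCompactOperator (B * K * star B) := (hK.clm_comp B).comp_clm (star B)
    have c3 : IsCompactOperator (K₂ * (A + K) * star B) := (hK₂.comp_clm (A + K)).comp_clm (star B)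
    exact ((c1.smul ((1 - ‖a‖ ^ 2 : ℝ) : ℂ)).add c2).add c3
  · rw [E_mul hb hψ hφ e, hE, defect_blaschkeFactor ha]
    exact conj_add_conj_eq _ h1 h2

theorem E_eq_zero_of_norm_const [Fact (-1 < α)] {φ : ℂ → ℂ} (hφ : MemHInftyUnitBall φ) {ζ : ℂ}
    (hζ : ‖ζ‖ = 1) (h : ∀ z ∈ unitDisk, φ z = ζ) : E α hφ = 0 := by
  have h1 : multiplier α φ = ζ • (1 : BergmanSpace α →L[ℂ] BergmanSpace α) := by
    ext f z
    rw [multiplier_apply hφ.memHInfty]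
    change φ z * f z = ζ * f z
    by_cases hz : z ∈ unitDisk
    · rw [h z hz]
    · rw [f.eq_zero_of_notMem hz, mul_zero, mul_zero]
  have h2 : ζ * star ζ = 1 := by
    rw [RCLike.star_def, Complex.mul_conj', hζ]
    simp
  rw [E_eq, h1, star_smul, star_one, smul_mul_smul_comm, mul_one, h2, one_smul, sub_self]

theorem memHInftyUnitBall_blaschkeProduct {n : ℕ} {a : Fin n → ℂ} {ζ : ℂ} (hζ : ‖ζ‖ = 1)
    (ha : ∀ i, a i ∈ unitDisk) :
    MemHInftyUnitBall (fun z => ζ * ∏ i, blaschkeFactor (a i) z) := by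
  refine ⟨(DifferentiableOn.fun_finsetProd
    (fun i _ => (memHInftyUnitBall_blaschkeFactor (ha i)).1)).const_mul ζ, fun z hz => ?_⟩
  rw [norm_mul, hζ, one_mul, norm_prod]
  exact Finset.prod_le_one (fun _ _ => norm_nonneg _)
    (fun i _ => (memHInftyUnitBall_blaschkeFactor (ha i)).2 z hz)

/-- For n = 0 the defect is zero, so only nonnegativity of A is available uniformly in n. Coercivity
is recovered in the next theorem by setting one factor aside. -/
theorem E_blaschkeProduct [hα : Fact (-1 < α)] (n : ℕ) : ∀ (a : Fin n → ℂ) (ζ : ℂ) (hζ : ‖ζ‖ = 1)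
    (ha : ∀ i, a i ∈ unitDisk), ∃ A K : BergmanSpace α →L[ℂ] BergmanSpace α,
      (∀ f, 0 ≤ (inner ℂ (A f) f : ℂ).re) ∧ IsCompactOperator K ∧
      E α (memHInftyUnitBall_blaschkeProduct hζ ha) = shiftDefect α * (A + K) := by
  induction n with
  | zero =>
    intro a ζ hζ ha
    refine ⟨0, 0, fun f => ?_, isCompactOperator_zero, ?_⟩
    · simp
    · rw [E_eq_zero_of_norm_const _ hζ (by simp), add_zero, mul_zero]
  | succ n ih =>
    intro a ζ hζ ha
    obtain ⟨A, K, hA, hK, hE⟩ := ih (fun i => a i.succ) ζ hζ (fun i => ha _)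
    obtain ⟨A', K', c, hc, hA', hK', hE'⟩ := E_blaschkeFactor_mul (ha 0) _
      (memHInftyUnitBall_blaschkeProduct hζ ha) (fun z _ => by
        rw [Fin.prod_univ_succ]; ring) hA hK hE
    exact ⟨A', K', fun f => le_trans (by positivity) (hA' f), hK', hE'⟩

/-- The defect operator of a nonconstant finite Blaschke product is the defect operator of the
shift composed with a surjective operator. -/
theorem exists_E_eq_of_isFiniteBlaschkeProduct [hα : Fact (-1 < α)] {φ : ℂ → ℂ}
    (hφ : MemHInftyUnitBall φ) (hconst : ¬ ∃ c : ℂ, ‖c‖ = 1 ∧ ∀ z ∈ unitDisk, φ z = c)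
    (h : IsFiniteBlaschkeProduct φ) :
    ∃ S : BergmanSpace α →L[ℂ] BergmanSpace α, Function.Surjective S ∧
      E α hφ = shiftDefect α * S := by
  obtain ⟨n, a, ζ, hζ, ha, hprod⟩ := h
  cases n with
  | zero => exact absurd ⟨ζ, hζ, fun z hz => by simpa using hprod z hz⟩ hconst
  | succ n =>
    obtain ⟨A, K, hA, hK, hE⟩ := E_blaschkeProduct (α := α) n (fun i => a i.succ) ζ hζ (fun i => ha _)
    obtain ⟨A', K', c, hc, hA', hK', hE'⟩ := E_blaschkeFactor_mul (ha 0) _ hφ (fun z hz => by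
        rw [hprod z hz, Fin.prod_univ_succ]; simp only [blaschkeFactor]; ring) hA hK hE
    refine ⟨A' + K', surjective_add_of_injective hc hA' hK' (fun f g hfg => ?_), hE'⟩
    apply E_injective hφ hconst
    rw [hE']
    exact congrArg (shiftDefect α) hfg

theorem rangeE_of_isFiniteBlaschkeProduct [hα : Fact (-1 < α)] {φ : ℂ → ℂ}
    (hφ : MemHInftyUnitBall φ) (hconst : ¬ ∃ c : ℂ, ‖c‖ = 1 ∧ ∀ z ∈ unitDisk, φ z = c)
    (h : IsFiniteBlaschkeProduct φ) : rangeE α hφ = (bergman (α - 2) : Set (ℂ → ℂ)) := by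
  obtain ⟨S, hS, hE⟩ := exists_E_eq_of_isFiniteBlaschkeProduct (α := α) hφ hconst h
  rw [← range_shiftDefect, rangeE, rangeE, hE]
  exact hS.range_comp (fun f => (shiftDefect α f : ℂ → ℂ))

/-! ### From range inclusion to compactness -/

/-- If the range of `E_φ` is contained in that of the defect operator of the shift, then `E_φ`
is compact. -/
theorem isCompactOperator_E_of_rangeE_subset [hα : Fact (-1 < α)] {φ : ℂ → ℂ}
    (hφ : MemHInftyUnitBall φ) (h : rangeE α hφ ⊆ (bergman (α - 2) : Set (ℂ → ℂ))) :
    IsCompactOperator (E α hφ) := by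
  rw [← range_shiftDefect] at h
  have h1 : ∀ f, ∃ g, shiftDefect α g = E α hφ f := by
    intro f
    obtain ⟨g, hg⟩ := h ⟨f, rfl⟩
    exact ⟨g, ext fun z => congrFun hg z⟩
  choose C hC using h1
  -- Injectivity of the shift defect makes the chosen preimages unique. This yields linearity, and
  -- also the closed graph below.
  let L : BergmanSpace α →ₗ[ℂ] BergmanSpace α :=
    { toFun := C
      map_add' := fun f g => shiftDefect_injective (by rw [map_add, hC, hC, hC, map_add])
      map_smul' := fun c f => shiftDefect_injective (by
        rw [RingHom.id_apply, map_smul, hC, hC, map_smul]) }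
  have hL : Continuous L := by
    refine LinearMap.continuous_of_seq_closed_graph L (fun u x y hu hy => ?_)
    refine shiftDefect_injective ?_
    refine tendsto_nhds_unique (((shiftDefect α).continuous.tendsto y).comp hy) ?_
    have h2 : (shiftDefect α ∘ L ∘ u) = E α hφ ∘ u := funext fun n => hC (u n)
    have h3 : shiftDefect α (L x) = E α hφ x := hC x
    rw [h2, h3]
    exact ((E α hφ).continuous.tendsto x).comp hu
  have h4 : (E α hφ : BergmanSpace α → BergmanSpace α) = shiftDefect α ∘ (⟨L, hL⟩ : BergmanSpace α →L[ℂ] BergmanSpace α) :=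
    funext fun f => (hC f).symm
  rw [h4]
  exact isCompactOperator_shiftDefect.comp_clm _

end BergmanSpace

/-! ### From compactness to unimodular boundary behaviour -/

/-- A bounded sequence which is weakly null against a set with dense span is weakly null. -/
theorem tendsto_inner_zero_of_dense_span {H : Type*} [NormedAddCommGroup H]
    [InnerProductSpace ℂ H] {k : ℕ → H} (hk : ∀ n, ‖k n‖ ≤ 1) {s : Set H}
    (hs : (Submodule.span ℂ s).topologicalClosure = ⊤)
    (h : ∀ x ∈ s, Tendsto (fun n => inner ℂ (k n) x) atTop (𝓝 0)) (y : H) :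
    Tendsto (fun n => inner ℂ (k n) y) atTop (𝓝 0) := by
  have hspan : ∀ x ∈ Submodule.span ℂ s, Tendsto (fun n => inner ℂ (k n) x) atTop (𝓝 0) := by
    intro x hx
    induction hx using Submodule.span_induction with
    | mem x hx => exact h x hx
    | zero => simp
    | add x y _ _ hx hy => simpa [inner_add_right] using hx.add hy
    | smul c x _ hx => simpa [inner_smul_right] using hx.const_mul c
  have hy : y ∈ closure (Submodule.span ℂ s : Set H) := by
    rw [← Submodule.topologicalClosure_coe, hs]
    trivial
  rw [Metric.tendsto_atTop]
  intro ε hε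
  obtain ⟨p, hp, hyp⟩ := Metric.mem_closure_iff.1 hy (ε / 2) (by positivity)
  obtain ⟨N, hN⟩ := Metric.tendsto_atTop.1 (hspan p hp) (ε / 2) (by positivity)
  refine ⟨N, fun n hn => ?_⟩
  have h1 := hN n hn
  rw [dist_zero_right] at h1 ⊢
  rw [dist_eq_norm] at hyp
  have h2 : inner ℂ (k n) y = inner ℂ (k n) (y - p) + inner ℂ (k n) p := by
    rw [← inner_add_right, sub_add_cancel]
  have h3 : ‖inner ℂ (k n) (y - p)‖ ≤ ‖y - p‖ :=
    (norm_inner_le_norm _ _).trans (mul_le_of_le_one_left (norm_nonneg _) (hk n))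
  rw [h2]
  linarith [norm_add_le (inner ℂ (k n) (y - p)) (inner ℂ (k n) p)]

/-- Along a subsequence S k_n converges in norm to some y. The inner product splits into a part
bounded by ‖S k_n - y‖ and a part ⟨k_n, y⟩, null by weak convergence. -/
theorem IsCompactOperator.tendsto_inner_zero {H : Type*} [NormedAddCommGroup H]
    [InnerProductSpace ℂ H] {S : H →L[ℂ] H} (hS : IsCompactOperator S) {k : ℕ → H}
    (hk : ∀ n, ‖k n‖ ≤ 1) (hw : ∀ y, Tendsto (fun n => inner ℂ (k n) y) atTop (𝓝 0)) :
    Tendsto (fun n => inner ℂ (k n) (S (k n))) atTop (𝓝 0) := by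
  refine tendsto_of_subseq_tendsto (fun ns hns => ?_)
  obtain ⟨C, hC, hsub⟩ := hS.image_closedBall_subset_compact (f := (S : H →ₗ[ℂ] H)) 1
  obtain ⟨y, -, ms, hms, hy⟩ := hC.tendsto_subseq (x := fun n => S (k (ns n)))
    (fun n => hsub ⟨k (ns n), by simpa using hk _, rfl⟩)
  refine ⟨ms, ?_⟩
  have h1 : Tendsto (fun n => inner ℂ (k (ns (ms n))) y) atTop (𝓝 0) :=
    (hw y).comp (hns.comp hms.tendsto_atTop)
  have h2 : Tendsto (fun n => inner ℂ (k (ns (ms n))) (S (k (ns (ms n))) - y)) atTop (𝓝 0) := by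
    rw [tendsto_iff_norm_sub_tendsto_zero] at hy
    refine squeeze_zero_norm (fun n => ?_) hy
    exact (norm_inner_le_norm _ _).trans (mul_le_of_le_one_left (norm_nonneg _) (hk _))
  simpa [inner_sub_right] using h2.add h1

namespace BergmanSpace

variable {α : ℝ}

/-- Existence of the reproducing kernel. -/
theorem exists_kernel [hα : Fact (-1 < α)] {w : ℂ} (hw : w ∈ unitDisk) :
    ∃ k : BergmanSpace α, ∀ f : BergmanSpace α, inner ℂ k f = f w := by
  obtain ⟨C, hC⟩ := exists_norm_le (α := α) (mem_unitDisk.1 hw)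
  let ev : BergmanSpace α →L[ℂ] ℂ := LinearMap.mkContinuous
    { toFun := fun f => f w
      map_add' := fun f g => rfl
      map_smul' := fun c f => rfl } C (fun f => hC f w (by simp))
  refine ⟨(InnerProductSpace.toDual ℂ (BergmanSpace α)).symm ev, fun f => ?_⟩
  rw [InnerProductSpace.toDual_symm_apply]
  rfl

/-- The n-th coefficient of the kernel has modulus |w|^n divided by the weight. The weights are at
most 1, so a geometric series bounds the norm from below; only its blow-up at the circle matters. -/
theorem kernel_norm_sq_ge [hα : Fact (-1 < α)] {w : ℂ} (hw : w ∈ unitDisk) {k : BergmanSpace α}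
    (hk : ∀ f : BergmanSpace α, inner ℂ k f = f w) : (1 - ‖w‖ ^ 2)⁻¹ ≤ ‖k‖ ^ 2 := by
  have hw1 := mem_unitDisk.1 hw
  have h1 : ∀ n, ‖w‖ ^ n = bergmanWeight α n * ‖taylorCoeff k n‖ := by
    intro n
    have h2 := congrArg norm (hk (monomial α n))
    rw [← inner_conj_symm, inner_monomial, Complex.norm_conj, monomial_apply n hw, norm_pow,
      norm_mul, Complex.norm_real, Real.norm_of_nonneg (bergmanWeight_pos hα.out n).le] at h2
    exact h2.symm
  refine hasSum_le (fun n => ?_) (hasSum_geometric_of_lt_one (sq_nonneg ‖w‖)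
    (pow_lt_one₀ (norm_nonneg _) hw1 two_ne_zero)) (hasSum_norm_sq k)
  have hω := bergmanWeight_pos hα.out n
  have hω1 := bergmanWeight_le_one hα.out n
  rw [← pow_mul, mul_comm 2 n, pow_mul, h1, mul_pow, pow_two (bergmanWeight α n), mul_assoc]
  exact mul_le_of_le_one_left (by positivity) hω1

/-- The kernel at w is an eigenvector of T_φ^* with eigenvalue conj(φ(w)). -/
theorem inner_kernel_E [hα : Fact (-1 < α)] {φ : ℂ → ℂ} (hφ : MemHInftyUnitBall φ) {w : ℂ}
    {k : BergmanSpace α} (hk : ∀ f : BergmanSpace α, inner ℂ k f = f w) :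
    inner ℂ k (E α hφ k) = ((1 - ‖φ w‖ ^ 2 : ℝ) : ℂ) * inner ℂ k k := by
  have h1 : ContinuousLinearMap.adjoint (T α hφ) k = conj (φ w) • k := by
    refine ext_inner_right ℂ (fun f => ?_)
    rw [ContinuousLinearMap.adjoint_inner_left, hk, T_apply, inner_smul_left, hk, Complex.conj_conj]
  change inner ℂ k (k - T α hφ (ContinuousLinearMap.adjoint (T α hφ) k)) = _
  rw [h1, map_smul, inner_sub_right, inner_smul_right, hk (T α hφ k), T_apply, ← hk k]
  have h2 := Complex.mul_conj' (φ w)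
  push_cast
  linear_combination (-(inner ℂ k k : ℂ)) * h2

theorem exists_lt_norm_sq_of_isCompactOperator [hα : Fact (-1 < α)] {φ : ℂ → ℂ}
    (hφ : MemHInftyUnitBall φ) (hc : IsCompactOperator (E α hφ)) {ε : ℝ} (hε : 0 < ε) :
    ∃ r < 1, ∀ z : ℂ, r < ‖z‖ → ‖z‖ < 1 → 1 - ε ≤ ‖φ z‖ ^ 2 := by
  by_contra! hcon
  have h1 : ∀ n : ℕ, ∃ z : ℂ, 1 - 1 / ((n : ℝ) + 1) < ‖z‖ ∧ ‖z‖ < 1 ∧ ‖φ z‖ ^ 2 < 1 - ε := by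
    intro n
    exact hcon _ (by
      have : 0 < 1 / ((n : ℝ) + 1) := by positivity
      linarith)
  choose w hw1 hw2 hw3 using h1
  have hwd : ∀ n, w n ∈ unitDisk := fun n => mem_unitDisk.2 (hw2 n)
  choose K hK using fun n => exists_kernel (α := α) (hwd n)
  have hlim : Tendsto (fun n => ‖w n‖) atTop (𝓝 1) := by
    refine tendsto_of_tendsto_of_tendsto_of_le_of_le (g := fun n : ℕ => 1 - 1 / ((n : ℝ) + 1)) ?_
      tendsto_const_nhds (fun n => (hw1 n).le) (fun n => (hw2 n).le)
    simpa using tendsto_one_div_add_atTop_nhds_zero_nat.const_sub (1 : ℝ)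
  have hpos : ∀ n, 0 < 1 - ‖w n‖ ^ 2 := fun n => by nlinarith [norm_nonneg (w n), hw2 n]
  have hKsq : ∀ n, (1 - ‖w n‖ ^ 2)⁻¹ ≤ ‖K n‖ ^ 2 := fun n => kernel_norm_sq_ge (hwd n) (hK n)
  have hK0 : ∀ n, 0 < ‖K n‖ := fun n => by
    have h2 := (inv_pos.2 (hpos n)).trans_le (hKsq n)
    refine (norm_nonneg _).lt_of_ne' (fun h3 => ?_)
    simp [h3] at h2
  have hKinv : Tendsto (fun n => ‖K n‖⁻¹) atTop (𝓝 0) := by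
    have h2 : Tendsto (fun n => √(1 - ‖w n‖ ^ 2)) atTop (𝓝 0) := by
      have := ((hlim.pow 2).const_sub 1).sqrt
      simpa using this
    refine squeeze_zero (fun n => (inv_pos.2 (hK0 n)).le) (fun n => ?_) h2
    refine Real.le_sqrt_of_sq_le ?_
    rw [inv_pow]
    exact inv_le_of_inv_le₀ (hpos n) (hKsq n)
  set k : ℕ → BergmanSpace α := fun n => (((‖K n‖⁻¹ : ℝ)) : ℂ) • K n with hk
  have hk1 : ∀ n, ‖k n‖ = 1 := fun n => by
    rw [hk, norm_smul, Complex.norm_real, Real.norm_of_nonneg (inv_pos.2 (hK0 n)).le,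
      inv_mul_cancel₀ (hK0 n).ne']
  have hinner : ∀ n f, inner ℂ (k n) f = ((‖K n‖⁻¹ : ℝ) : ℂ) * f (w n) := fun n f => by
    rw [hk, inner_smul_left, Complex.conj_ofReal, hK]
  -- Against z^m the normalized kernel gives w_n^m / ‖K_n‖, which is at most 1/‖K_n‖ in modulus; the
  -- unit norms and the dense span of the monomials do the rest.
  have hweak : ∀ y, Tendsto (fun n => inner ℂ (k n) y) atTop (𝓝 0) := by
    refine tendsto_inner_zero_of_dense_span (fun n => (hk1 n).le) (monomialBasis α).dense_span ?_
    rintro _ ⟨m, rfl⟩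
    rw [monomialBasis_apply, unitMonomial]
    simp only [inner_smul_right]
    rw [← mul_zero (((√(bergmanWeight α m))⁻¹ : ℝ) : ℂ)]
    refine Tendsto.const_mul _ ?_
    refine squeeze_zero_norm (fun n => ?_) hKinv
    rw [hinner, norm_mul, Complex.norm_real, Real.norm_of_nonneg (inv_pos.2 (hK0 n)).le,
      monomial_apply m (hwd n), norm_pow]
    exact mul_le_of_le_one_right (inv_pos.2 (hK0 n)).le (pow_le_one₀ (norm_nonneg _) (hw2 n).le)
  have hlim2 := hc.tendsto_inner_zero (fun n => (hk1 n).le) hweak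
  have hval : ∀ n, inner ℂ (k n) (E α hφ (k n)) = ((1 - ‖φ (w n)‖ ^ 2 : ℝ) : ℂ) := by
    intro n
    have h2 : (‖K n‖ : ℂ) ≠ 0 := by exact_mod_cast (hK0 n).ne'
    have h3 := inner_self_eq_norm_sq_to_K (𝕜 := ℂ) (K n)
    have h3' : inner ℂ (K n) (K n) = (‖K n‖ : ℂ) ^ 2 := h3
    rw [hk]
    simp only [map_smul, inner_smul_left, inner_smul_right, Complex.conj_ofReal]
    rw [inner_kernel_E hφ (hK n), h3']
    push_cast
    field_simp
  have hge : ∀ n, ε ≤ ‖inner ℂ (k n) (E α hφ (k n))‖ := fun n => by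
    rw [hval, Complex.norm_real]
    refine le_trans ?_ (le_abs_self _)
    linarith [hw3 n]
  have := ge_of_tendsto' hlim2.norm hge
  rw [norm_zero] at this
  linarith

end BergmanSpace

/-! ### Unimodular boundary behaviour characterizes finite Blaschke products -/

/-- The filter of points of the disk tending to the unit circle. -/
def toUnitCircle : Filter ℂ := comap (fun z => ‖z‖) (𝓝[<] 1)

theorem eventually_toUnitCircle {p : ℂ → Prop} :
    (∀ᶠ z in toUnitCircle, p z) ↔ ∃ r < 1, ∀ z : ℂ, r < ‖z‖ → ‖z‖ < 1 → p z := by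
  rw [toUnitCircle, eventually_comap, (nhdsLT_basis (1 : ℝ)).eventually_iff]
  constructor
  · rintro ⟨r, hr, h⟩
    exact ⟨r, hr, fun z h1 h2 => h ⟨h1, h2⟩ z rfl⟩
  · rintro ⟨r, hr, h⟩
    refine ⟨r, hr, ?_⟩
    rintro _ ⟨h1, h2⟩ z rfl
    exact h z h1 h2

instance : toUnitCircle.NeBot := by
  refine ⟨fun h => ?_⟩
  have h1 : ∀ᶠ z in toUnitCircle, False := by rw [h]; trivial
  obtain ⟨r, hr, h2⟩ := eventually_toUnitCircle.1 h1
  have h3 : 0 ≤ (max r 0 + 1) / 2 := by positivity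
  have h4 : max r 0 < 1 := max_lt hr one_pos
  have h5 : r ≤ max r 0 := le_max_left _ _
  have h6 : 0 ≤ max r 0 := le_max_right _ _
  refine h2 (((max r 0 + 1) / 2 : ℝ) : ℂ) ?_ ?_ <;>
  rw [Complex.norm_real, Real.norm_of_nonneg h3] <;> linarith

theorem eventually_mem_unitDisk : ∀ᶠ z in toUnitCircle, z ∈ unitDisk :=
  eventually_toUnitCircle.2 ⟨0, one_pos, fun _ _ h => mem_unitDisk.2 h⟩

theorem tendsto_norm_toUnitCircle : Tendsto (fun z : ℂ => ‖z‖) toUnitCircle (𝓝 1) :=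
  tendsto_comap.mono_right nhdsWithin_le_nhds

/-- Maximum principle for functions whose modulus tends to `1` at the boundary. -/
theorem norm_le_one_of_tendsto {f : ℂ → ℂ} (hf : DifferentiableOn ℂ f unitDisk)
    (hb : Tendsto (fun z => ‖f z‖) toUnitCircle (𝓝 1)) : ∀ z ∈ unitDisk, ‖f z‖ ≤ 1 := by
  intro z hz
  rw [mem_unitDisk] at hz
  refine le_of_forall_gt_imp_ge_of_dense (fun C hC => ?_)
  obtain ⟨r, hr, h⟩ := eventually_toUnitCircle.1 (hb.eventually_lt_const hC)
  obtain ⟨R, hR1, hR2⟩ := exists_between (max_lt (max_lt hr hz) one_pos)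
  have hr' : r < R := ((le_max_left _ _).trans (le_max_left _ _)).trans_lt hR1
  have hz' : ‖z‖ < R := ((le_max_right _ _).trans (le_max_left _ _)).trans_lt hR1
  have hR0 : 0 < R := (le_max_right _ _).trans_lt hR1
  have hd : DiffContOnCl ℂ f (ball 0 R) := by
    refine DifferentiableOn.diffContOnCl ?_
    rw [closure_ball _ hR0.ne']
    exact hf.mono (closedBall_subset_ball hR2)
  refine Complex.norm_le_of_forall_mem_frontier_norm_le isBounded_ball hd (fun w hw => ?_)
    (subset_closure (by simpa using hz'))
  rw [frontier_ball _ hR0.ne', mem_sphere_zero_iff_norm] at hw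
  exact (h w (by rw [hw]; exact hr') (by rw [hw]; exact hR2)).le

theorem isFiniteBlaschkeProduct_of_const {f : ℂ → ℂ} {c : ℂ} (hc : ‖c‖ = 1)
    (h : ∀ z ∈ unitDisk, f z = c) : IsFiniteBlaschkeProduct f :=
  ⟨0, Fin.elim0, c, hc, fun i => i.elim0, fun z hz => by simpa using h z hz⟩

theorem isFiniteBlaschkeProduct_of_norm_eq_one {f : ℂ → ℂ} (hf : MemHInftyUnitBall f) {z : ℂ}
    (hz : z ∈ unitDisk) (h : 1 ≤ ‖f z‖) : IsFiniteBlaschkeProduct f := by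
  by_contra hcon
  refine absurd (hf.norm_lt_one (fun ⟨c, hc, hc'⟩ => hcon ?_) hz) (not_lt.2 h)
  exact isFiniteBlaschkeProduct_of_const hc hc'

/-- The maximum principle applies to both f and 1/f, so |f| = 1 at the origin and f is constant. -/
theorem isFiniteBlaschkeProduct_of_ne_zero {f : ℂ → ℂ} (hf : DifferentiableOn ℂ f unitDisk)
    (hb : Tendsto (fun z => ‖f z‖) toUnitCircle (𝓝 1)) (h0 : ∀ z ∈ unitDisk, f z ≠ 0) :
    IsFiniteBlaschkeProduct f := by
  have h1 := norm_le_one_of_tendsto (f := fun z => (f z)⁻¹) (hf.fun_inv h0)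
    (by simpa [norm_inv] using hb.inv₀ one_ne_zero)
  have h00 : (0 : ℂ) ∈ unitDisk := by simp [mem_unitDisk]
  refine isFiniteBlaschkeProduct_of_norm_eq_one ⟨hf, norm_le_one_of_tendsto hf hb⟩ h00 ?_
  have h2 := h1 0 h00
  rw [norm_inv] at h2
  exact (inv_le_one₀ (norm_pos_iff.2 (h0 0 h00))).1 h2

theorem IsFiniteBlaschkeProduct.blaschkeFactor_mul {f g : ℂ → ℂ} {a : ℂ} (ha : a ∈ unitDisk)
    (hg : IsFiniteBlaschkeProduct g) (h : ∀ z ∈ unitDisk, f z = blaschkeFactor a z * g z) :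
    IsFiniteBlaschkeProduct f := by
  obtain ⟨n, b, ζ, hζ, hb, hprod⟩ := hg
  refine ⟨n + 1, Fin.cons a b, ζ, hζ, fun i => ?_, fun z hz => ?_⟩
  · refine Fin.cases ?_ (fun i => ?_) i
    · exact ha
    · exact hb i
  · rw [h z hz, hprod z hz, Fin.prod_univ_succ]
    simp only [Fin.cons_zero, Fin.cons_succ, blaschkeFactor]
    ring

theorem tendsto_norm_blaschkeFactor {a : ℂ} (ha : a ∈ unitDisk) :
    Tendsto (fun z => ‖blaschkeFactor a z‖) toUnitCircle (𝓝 1) := by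
  have ha1 := mem_unitDisk.1 ha
  have h1 : Tendsto (fun z => ‖blaschkeFactor a z‖ ^ 2) toUnitCircle (𝓝 1) := by
    have h2 : Tendsto (fun z : ℂ => 1 - (1 - ‖a‖ ^ 2) * (1 - ‖z‖ ^ 2) / (1 - ‖a‖) ^ 2)
        toUnitCircle (𝓝 1) := by
      have := ((((tendsto_norm_toUnitCircle.pow 2).const_sub 1).const_mul
        (1 - ‖a‖ ^ 2)).div_const ((1 - ‖a‖) ^ 2)).const_sub 1
      simpa using this
    refine tendsto_of_tendsto_of_tendsto_of_le_of_le' h2 tendsto_const_nhds ?_ ?_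
    · filter_upwards [eventually_mem_unitDisk] with z hz
      rw [norm_blaschkeFactor_sq ha hz]
      have h3 := one_sub_norm_le (a := a) hz
      have hz1 := mem_unitDisk.1 hz
      have h4 : 0 ≤ 1 - ‖a‖ ^ 2 := by nlinarith [norm_nonneg a]
      have h5 : 0 ≤ 1 - ‖z‖ ^ 2 := by nlinarith [norm_nonneg z]
      have h6 : 0 < 1 - ‖a‖ := by linarith
      gcongr
    · filter_upwards [eventually_mem_unitDisk] with z hz
      exact pow_le_one₀ (norm_nonneg _) ((memHInftyUnitBall_blaschkeFactor ha).2 z hz)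
  simpa using h1.sqrt

/-- Dividing out a zero. -/
theorem exists_eq_blaschkeFactor_mul {f : ℂ → ℂ} (hf : DifferentiableOn ℂ f unitDisk)
    (hb : Tendsto (fun z => ‖f z‖) toUnitCircle (𝓝 1)) {a : ℂ} (ha : a ∈ unitDisk)
    (hfa : f a = 0) :
    ∃ g : ℂ → ℂ, DifferentiableOn ℂ g unitDisk ∧
      Tendsto (fun z => ‖g z‖) toUnitCircle (𝓝 1) ∧
      ∀ z ∈ unitDisk, f z = blaschkeFactor a z * g z := by
  have hfac : ∀ z ∈ unitDisk, f z = blaschkeFactor a z * ((1 - conj a * z) * dslope f a z) := by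
    intro z hz
    have h1 := sub_smul_dslope f a z
    rw [hfa, sub_zero, smul_eq_mul] at h1
    rw [← h1, blaschkeFactor, ← mul_assoc, div_mul_cancel₀ _ (one_sub_conj_mul_ne_zero ha hz)]
  refine ⟨fun z => (1 - conj a * z) * dslope f a z, ?_, ?_, hfac⟩
  · exact DifferentiableOn.fun_mul (by fun_prop)
      ((Complex.differentiableOn_dslope (isOpen_unitDisk.mem_nhds ha)).2 hf)
  · have h2 := hb.div (tendsto_norm_blaschkeFactor ha) one_ne_zero
    rw [div_one] at h2
    refine h2.congr' ?_
    filter_upwards [eventually_mem_unitDisk,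
      (tendsto_norm_blaschkeFactor ha).eventually_ne one_ne_zero] with z hz hz0
    rw [Pi.div_apply, hfac z hz, norm_mul, mul_div_cancel_left₀ _ hz0]

/-- Zeros are divided out one at a time, and termination is measured at a fixed point z₀ with f(z₀)
≠ 0 instead of by counting multiplicities. All zeros stay in |z| ≤ s < 1, so each division increases
|f(z₀)|² at least by a fixed factor 1/q > 1, while the maximum principle bounds it by 1. -/
theorem isFiniteBlaschkeProduct_of_tendsto {f : ℂ → ℂ} (hf : DifferentiableOn ℂ f unitDisk)
    (hb : Tendsto (fun z => ‖f z‖) toUnitCircle (𝓝 1)) : IsFiniteBlaschkeProduct f := by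
  obtain ⟨r, hr, hfr⟩ := eventually_toUnitCircle.1 (hb.eventually_ne one_ne_zero)
  obtain ⟨z₀, hz₀, hfz₀⟩ := (eventually_mem_unitDisk.and (hb.eventually_ne one_ne_zero)).exists
  have hzeros : ∀ z ∈ unitDisk, f z = 0 → ‖z‖ ≤ max r 0 := by
    intro z hz hfz
    refine le_max_of_le_left (not_lt.1 (fun h => ?_))
    exact hfr z h (mem_unitDisk.1 hz) (by rw [hfz, norm_zero])
  clear hfr
  generalize hs : max r 0 = s at hzeros
  have hs0 : 0 ≤ s := by rw [← hs]; exact le_max_right _ _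
  have hs1 : s < 1 := by rw [← hs]; exact max_lt hr one_pos
  have hz₀1 := mem_unitDisk.1 hz₀
  have h1 : 0 < 1 - s ^ 2 := by nlinarith
  have h2 : 0 < 1 - ‖z₀‖ ^ 2 := by nlinarith [norm_nonneg z₀]
  -- An upper bound for the squared modulus at z₀ of any Blaschke factor with zero in |a| ≤ s; the 4
  -- comes from |1 - conj(a) z₀| ≤ 2.
  set q : ℝ := 1 - (1 - s ^ 2) * (1 - ‖z₀‖ ^ 2) / 4 with hq
  have hq1 : q < 1 := by
    have : 0 < (1 - s ^ 2) * (1 - ‖z₀‖ ^ 2) / 4 := by positivity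
    linarith
  have hq0 : 0 < q := by
    have : (1 - s ^ 2) * (1 - ‖z₀‖ ^ 2) ≤ 1 * 1 :=
      mul_le_mul (by nlinarith) (by nlinarith [sq_nonneg ‖z₀‖]) h2.le zero_le_one
    linarith
  have hbq : ∀ a ∈ unitDisk, ‖a‖ ≤ s → ‖blaschkeFactor a z₀‖ ^ 2 ≤ q := by
    intro a ha has
    rw [norm_blaschkeFactor_sq ha hz₀, hq]
    have h3 : ‖1 - conj a * z₀‖ ^ 2 ≤ 4 := by
      have h4 : ‖1 - conj a * z₀‖ ≤ 2 := by
        refine (norm_sub_le _ _).trans ?_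
        rw [norm_one, norm_mul, Complex.norm_conj]
        nlinarith [norm_nonneg a, norm_nonneg z₀]
      nlinarith [norm_nonneg (1 - conj a * z₀)]
    have h5 : 0 < ‖1 - conj a * z₀‖ ^ 2 :=
      pow_pos (norm_pos_iff.2 (one_sub_conj_mul_ne_zero ha hz₀)) 2
    have h6 : 0 ≤ 1 - ‖a‖ ^ 2 := by nlinarith [norm_nonneg a]
    gcongr
  obtain ⟨N, hN⟩ := exists_pow_lt_of_lt_one
    (pow_pos ((norm_nonneg (f z₀)).lt_of_ne' hfz₀) 2) hq1
  have hN' := hN.le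
  clear hN hfz₀
  -- The induction carries q^N ≤ |f(z₀)|². At N = 0 this puts modulus 1 at an interior point, so f
  -- is constant; the bound s on the zeros passes to quotients.
  induction N generalizing f with
  | zero =>
    refine isFiniteBlaschkeProduct_of_norm_eq_one ⟨hf, norm_le_one_of_tendsto hf hb⟩ hz₀ ?_
    rw [pow_zero] at hN'
    exact (one_le_pow_iff_of_nonneg (norm_nonneg _) two_ne_zero).1 hN'
  | succ N ih =>
    by_cases h0 : ∀ z ∈ unitDisk, f z ≠ 0
    · exact isFiniteBlaschkeProduct_of_ne_zero hf hb h0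
    push Not at h0
    obtain ⟨a, ha, hfa⟩ := h0
    obtain ⟨g, hg, hgb, hfg⟩ := exists_eq_blaschkeFactor_mul hf hb ha hfa
    refine IsFiniteBlaschkeProduct.blaschkeFactor_mul ha (ih hg hgb (fun z hz hgz => ?_) ?_) hfg
    · exact hzeros z hz (by rw [hfg z hz, hgz, mul_zero])
    · rw [hfg z₀ hz₀, norm_mul, mul_pow, pow_succ'] at hN'
      have h3 := hbq a ha (hzeros a ha hfa)
      have h4 : q * q ^ N ≤ q * ‖g z₀‖ ^ 2 :=
        hN'.trans (mul_le_mul_of_nonneg_right h3 (sq_nonneg _))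
      exact le_of_mul_le_mul_left h4 hq0

theorem isFiniteBlaschkeProduct_of_isCompactOperator {α : ℝ} [Fact (-1 < α)] {φ : ℂ → ℂ}
    (hφ : MemHInftyUnitBall φ) (hc : IsCompactOperator (BergmanSpace.E α hφ)) :
    IsFiniteBlaschkeProduct φ := by
  refine isFiniteBlaschkeProduct_of_tendsto hφ.differentiableOn ?_
  have h1 : Tendsto (fun z => ‖φ z‖ ^ 2) toUnitCircle (𝓝 1) := by
    refine tendsto_order.2 ⟨fun c hc1 => ?_, fun c hc1 => ?_⟩
    · obtain ⟨r, hr, h⟩ := BergmanSpace.exists_lt_norm_sq_of_isCompactOperator hφ hc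
        (show 0 < (1 - c) / 2 by linarith)
      refine eventually_toUnitCircle.2 ⟨r, hr, fun z h2 h3 => ?_⟩
      linarith [h z h2 h3]
    · filter_upwards [eventually_mem_unitDisk] with z hz
      exact (pow_le_one₀ (norm_nonneg _) (hφ.norm_le_one z hz)).trans_lt hc1
  simpa using h1.sqrt


end

/-! ### The equivalence -/

theorem theorem17 (α : ℝ) [Fact (-1 < α)] (φ : ℂ → ℂ) (hφ : MemHInftyUnitBall φ)
    (hconst : ¬ ∃ c : ℂ, ‖c‖ = 1 ∧ ∀ z ∈ unitDisk, φ z = c) :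
    List.TFAE
      [IsCompactOperator (BergmanSpace.E α hφ),
       IsFiniteBlaschkeProduct φ,
       BergmanSpace.rangeE α hφ = (bergman (α - 2) : Set (ℂ → ℂ)),
       BergmanSpace.rangeE α hφ ⊆ (bergman (α - 2) : Set (ℂ → ℂ))] := by
  tfae_have 1 → 2 := isFiniteBlaschkeProduct_of_isCompactOperator hφ
  tfae_have 2 → 3 := BergmanSpace.rangeE_of_isFiniteBlaschkeProduct hφ hconst
  tfae_have 3 → 4 := fun h => h.subset
  tfae_have 4 → 1 := BergmanSpace.isCompactOperator_E_of_rangeE_subset hφ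
  tfae_finish
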